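/- Let $n$ be a natural number. A partial $t$-$(v,k,\lambda)$-design is a set of $v$ points with a set of $k$-element subsets (blocks) such that every $t$-element set of points lies in at most $\lambda$ blocks; it is a $t$-$(v,k,\lambda)$-design if every such set lies in exactly $\lambda$ blocks. Let $\mathcal I$ be a partial inversive plane of order $n$, i.e. a partial $3$-$(n^2+1,n+1,1)$-design; its blocks are called circles. For a point $P$, the derived structure $\mathcal I_P$ has as points the points of $\mathcal I$ different from $P$, and as lines the sets $c\setminus\{P\}$, where $c$ is a circle through $P$. Two lines are parallel if they coincide or have no common point, and the valency of a point of $\mathcal I_P$ is the number of lines of $\mathcal I_P$ through it. Suppose that for every point $P$ of $\mathcal I$ at least one of the following holds: (i) there are at least $n^2+n-\sqrt n$ circles through $P$, and parallelism is an equivalence relation on the lines of $\mathcal I_P$; (ii) at most one point of $\mathcal I_P$ has valency less than $n$, and parallelism is an equivalence relation on the lines of $\mathcal I_P$; (iii) $\mathcal I_P$ has exactly $n^2+n-e$ lines for some integer $e\ge 0$, and at least one of the following holds: - (a) $e<\sqrt n+1$ and some point of $\mathcal I_P$ has valency $n+1-e$; - (b) $e<\sqrt n$ and some line of $\mathcal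 I_P$ contains only points of valency $n+1$; - (c) $n\ge 2$ and $e=1$; - (d) $n\ge 4$ and $e=2$. Then $\mathcal I$ can be completed to an inversive plane: circles can be added to $\mathcal I$, on the same point set, such that the result is a $3$-$(n^2+1,n+1,1)$-design. -/

import Mathlib

/-- A partial `t`-`(v, k, lam)`-design on the point set `V` with block set `B`: there are `v` points,
every block is a `k`-element set of points, and every `t`-element set of points is contained in
at most `lam` blocks. -/
def IsPartialDesign {V : Type*} [Fintype V] [DecidableEq V] (t v k lam : ℕ)
    (B : Finset (Finset V)) : Prop :=
  Fintype.card V = v ∧ (∀ b ∈ B, b.card = k) ∧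
    ∀ T : Finset V, T.card = t → (B.filter (fun b => T ⊆ b)).card ≤ lam

/-- A `t`-`(v, k, lam)`-design on the point set `V` with block set `B`: there are `v` points,
every block is a `k`-element set of points, and every `t`-element set of points is contained in
exactly `lam` blocks. -/
def IsDesign {V : Type*} [Fintype V] [DecidableEq V] (t v k lam : ℕ)
    (B : Finset (Finset V)) : Prop :=
  Fintype.card V = v ∧ (∀ b ∈ B, b.card = k) ∧
    ∀ T : Finset V, T.card = t → (B.filter (fun b => T ⊆ b)).card = lam

/-- A partial inversive plane of order `n`: a partial `3`-`(n ^ 2 + 1, n + 1, 1)`-design. Its blocks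
are called circles. -/
def IsPartialInversivePlane {V : Type*} [Fintype V] [DecidableEq V] (n : ℕ)
    (C : Finset (Finset V)) : Prop :=
  IsPartialDesign 3 (n ^ 2 + 1) (n + 1) 1 C

/-- An inversive plane of order `n`: a `3`-`(n ^ 2 + 1, n + 1, 1)`-design. -/
def IsInversivePlane {V : Type*} [Fintype V] [DecidableEq V] (n : ℕ)
    (C : Finset (Finset V)) : Prop :=
  IsDesign 3 (n ^ 2 + 1) (n + 1) 1 C

/-- The blocks containing a given point `P`. -/
def blocksThrough {V : Type*} [DecidableEq V] (B : Finset (Finset V)) (P : V) :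
    Finset (Finset V) :=
  B.filter (fun b => P ∈ b)

/-- The valency of a point: the number of blocks (lines) containing it. -/
def valency {V : Type*} [DecidableEq V] (B : Finset (Finset V)) (P : V) : ℕ :=
  (blocksThrough B P).card

/-- The lines of the derived structure at `P`, whose points are the points different from `P`:
the circles containing `P`, with `P` removed. -/
def derivedLines {V : Type*} [DecidableEq V] (C : Finset (Finset V)) (P : V) :
    Finset (Finset {Q : V // Q ≠ P}) :=
  (blocksThrough C P).image (fun c => c.subtype (fun Q => Q ≠ P))

/-- Two lines are parallel if they coincide or have no point in common. -/
def Parallel {W : Type*} (l m : Finset W) : Prop :=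
  l = m ∨ Disjoint l m

/-- Parallelism is an equivalence relation on the set `L` of lines. -/
def ParallelismIsEquivalence {W : Type*} (L : Finset (Finset W)) : Prop :=
  Equivalence (fun l m : {l : Finset W // l ∈ L} => Parallel l.1 m.1)

/-- First completion criterion of Dow, for a partial affine plane of order `n` with line set `L`:
there are `n ^ 2 + n - e` lines and either `e < √n + 1` and some point has valency `n + 1 - e`,
or `e < √n` and some line contains only points of valency `n + 1`. -/
def DowFewMissing {W : Type*} [DecidableEq W] (n : ℕ) (L : Finset (Finset W)) : Prop :=
  ∃ e : ℕ, L.card + e = n ^ 2 + n ∧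
    (((e : ℝ) < Real.sqrt (n : ℝ) + 1 ∧ ∃ Q : W, valency L Q + e = n + 1) ∨
      ((e : ℝ) < Real.sqrt (n : ℝ) ∧ ∃ l ∈ L, ∀ Q ∈ l, valency L Q = n + 1))

/-- Second completion criterion of Dow, for a partial affine plane of order `n` with line set `L`:
`n ≥ 2` and there are `n ^ 2 + n - 1` lines, or `n ≥ 4` and there are `n ^ 2 + n - 2` lines. -/
def DowOneOrTwoMissing {W : Type*} (n : ℕ) (L : Finset (Finset W)) : Prop :=
  (2 ≤ n ∧ L.card + 1 = n ^ 2 + n) ∨ (4 ≤ n ∧ L.card + 2 = n ^ 2 + n)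

/-! The proof has a local half, completing each derived structure to an affine plane, and a global
half, showing that these completions fit together.

Local half. In a partial affine plane with `e` lines missing, a point of defect `d` is unjoined to
exactly `(n - 1) * d` others. A point of defect one together with its unjoined points therefore has
`n` elements, and this star is the only candidate for the missing line through it. By
`exists_isCompletion` the stars do complete the plane once each line has at most one disjoint line
through each point of defect one outside it, distinct stars share at most one point, and fewer than
`n` points have defect at least two. If parallelism is an equivalence relation, the first condition
is immediate; with at least `n ^ 2 + n - √n` lines, the other two follow from counting parallel
classes and from Cauchy-Schwarz. Under Dow's criteria the first condition has to be proved: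
`parallelLines_subset` shows that parallelism is transitive on a family of lines closed under
parallels, free of points of defect above one and with exactly `k` points of defect one on each
line, where `k ^ 2 < n`. With a point of defect `e` this applies with `k = e - 1`, with a line of
points of defect zero it applies with `k = e`. One missing line falls under the first case. Two
missing lines fall under one of the two, except for `n = 4`, where `k ^ 2 = n` and a separate
argument is needed.

Global half. Being contained in no circle is a symmetric property of a triple of points, so the new
circles at different points cover the same triples. The criteria moreover leave few new circles at
`P`, or at most one other point lying on several of them. Counting then shows that a new circle at
`P` is a new circle at each of its points (`mem_of_mem`), so adding all new circles gives an
inversive plane. Orders at most two are treated directly. -/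

/-- A partial affine plane of order `n`: a set of `n`-subsets of a set of `n ^ 2` points, any two of
which share at most one point. -/
structure IsPartialAffine {W : Type*} [Fintype W] [DecidableEq W] (n : ℕ)
    (L : Finset (Finset W)) : Prop where
  card_points : Fintype.card W = n ^ 2
  card_line : ∀ l ∈ L, l.card = n
  eq_of_mem : ∀ l ∈ L, ∀ m ∈ L, ∀ Q R, Q ≠ R → Q ∈ l → R ∈ l → Q ∈ m → R ∈ m → l = m

/-! ### Incidence counting -/

section Incidence

variable {W : Type*} [DecidableEq W]

/-- The lines having no point in common with `l`. -/
def disjointLines (L : Finset (Finset W)) (l : Finset W) : Finset (Finset W) :=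
  L.filter (fun m => Disjoint m l)

/-- The lines through `Q` having no point in common with `l`. -/
def disjointLinesThrough (L : Finset (Finset W)) (Q : W) (l : Finset W) : Finset (Finset W) :=
  L.filter (fun m => Q ∈ m ∧ Disjoint m l)

theorem mem_disjointLines {L : Finset (Finset W)} {l m : Finset W} :
    m ∈ disjointLines L l ↔ m ∈ L ∧ Disjoint m l := by
  simp [disjointLines]

theorem mem_disjointLinesThrough {L : Finset (Finset W)} {Q : W} {l m : Finset W} :
    m ∈ disjointLinesThrough L Q l ↔ m ∈ L ∧ Q ∈ m ∧ Disjoint m l := by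
  simp [disjointLinesThrough]

theorem mem_blocksThrough {L : Finset (Finset W)} {Q : W} {l : Finset W} :
    l ∈ blocksThrough L Q ↔ l ∈ L ∧ Q ∈ l := by
  simp [blocksThrough]

/-- Double counting of incidences between a set of points and a set of lines. -/
theorem sum_card_filter_mem (s : Finset W) (K : Finset (Finset W)) :
    ∑ Q ∈ s, (K.filter (fun m => Q ∈ m)).card = ∑ m ∈ K, (s.filter (fun Q => Q ∈ m)).card :=
  Finset.sum_card_bipartiteAbove_eq_sum_card_bipartiteBelow (fun Q m => Q ∈ m)

/-- Weighted double counting of incidences. -/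
theorem sum_valency_mul (s : Finset W) (L : Finset (Finset W)) (w : W → ℕ) :
    ∑ Q ∈ s, (L.filter (fun m => Q ∈ m)).card * w Q =
      ∑ m ∈ L, ∑ Q ∈ s.filter (fun Q => Q ∈ m), w Q := by
  simp_rw [Finset.sum_filter, Finset.card_filter, Finset.sum_mul]
  rw [Finset.sum_comm]
  refine Finset.sum_congr rfl fun m _ => Finset.sum_congr rfl fun Q _ => ?_
  split_ifs <;> simp

end Incidence

/-! ### Defects and unjoined points in a partial affine plane -/

section Basic

variable {W : Type*} [Fintype W] [DecidableEq W]

/-- The points different from `Q` that are not joined to `Q` by a line. -/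
def unjoined (L : Finset (Finset W)) (Q : W) : Finset W :=
  Finset.univ.filter (fun R => R ≠ Q ∧ ∀ l ∈ L, ¬ (Q ∈ l ∧ R ∈ l))

/-- The number of lines through `Q` missing from a complete affine plane of order `n`. -/
def defect (n : ℕ) (L : Finset (Finset W)) (Q : W) : ℕ := n + 1 - valency L Q

theorem mem_unjoined {L : Finset (Finset W)} {Q R : W} :
    R ∈ unjoined L Q ↔ R ≠ Q ∧ ∀ l ∈ L, ¬ (Q ∈ l ∧ R ∈ l) := by
  simp [unjoined]

theorem unjoined_symm {L : Finset (Finset W)} {Q R : W} (h : R ∈ unjoined L Q) :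
    Q ∈ unjoined L R := by
  rw [mem_unjoined] at h ⊢
  exact ⟨h.1.symm, fun l hl hh => h.2 l hl hh.symm⟩

theorem exists_line_of_notMem_unjoined {L : Finset (Finset W)} {Q R : W} (hne : R ≠ Q)
    (h : R ∉ unjoined L Q) : ∃ l ∈ L, Q ∈ l ∧ R ∈ l := by
  rw [mem_unjoined] at h
  push Not at h
  exact h hne

theorem self_notMem_unjoined {L : Finset (Finset W)} {Q : W} : Q ∉ unjoined L Q := by
  simp [mem_unjoined]

variable {n : ℕ} {L : Finset (Finset W)}

namespace IsPartialAffine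

theorem eq_of_inter (hL : IsPartialAffine n L) {l m : Finset W} (hl : l ∈ L) (hm : m ∈ L)
    {Q R : W} (hne : l ≠ m) (hQl : Q ∈ l) (hQm : Q ∈ m) (hRl : R ∈ l) (hRm : R ∈ m) : Q = R := by
  by_contra h
  exact hne (hL.eq_of_mem l hl m hm Q R h hQl hRl hQm hRm)

/-- Lines through a point partition the points joined to it. -/
theorem card_unjoined_add (hL : IsPartialAffine n L) (Q : W) :
    (unjoined L Q).card + valency L Q * (n - 1) = n ^ 2 - 1 := by
  have h1 : (blocksThrough L Q).biUnion (fun l => l.erase Q) =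
      (Finset.univ.erase Q) \ unjoined L Q := by
    ext R
    simp only [Finset.mem_biUnion, mem_blocksThrough, Finset.mem_erase, Finset.mem_sdiff,
      mem_unjoined, Finset.mem_univ, and_true]
    constructor
    · rintro ⟨l, ⟨hl, hQ⟩, hR, hRl⟩
      exact ⟨hR, fun h => h.2 l hl ⟨hQ, hRl⟩⟩
    · rintro ⟨hR, h⟩
      push Not at h
      obtain ⟨l, hl, hQ, hRl⟩ := h hR
      exact ⟨l, ⟨hl, hQ⟩, hR, hRl⟩
  have h2 : ((blocksThrough L Q).biUnion (fun l => l.erase Q)).card = valency L Q * (n - 1) := by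
    rw [Finset.card_biUnion, valency, Finset.sum_const_nat]
    · intro l hl
      rw [mem_blocksThrough] at hl
      rw [Finset.card_erase_of_mem hl.2, hL.card_line l hl.1]
    · intro l hl m hm hne
      rw [Finset.mem_coe, mem_blocksThrough] at hl hm
      rw [Function.onFun, Finset.disjoint_left]
      intro R hR hR'
      rw [Finset.mem_erase] at hR hR'
      exact hne (hL.eq_of_mem l hl.1 m hm.1 Q R hR.1.symm hl.2 hR.2 hm.2 hR'.2)
  have hsub : unjoined L Q ⊆ Finset.univ.erase Q := by
    intro R hR
    rw [mem_unjoined] at hR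
    simp [hR.1]
  rw [← h2, h1, Finset.card_sdiff_of_subset hsub, Finset.card_erase_of_mem (Finset.mem_univ _),
    Finset.card_univ, hL.card_points]
  have := Finset.card_le_card hsub
  rw [Finset.card_erase_of_mem (Finset.mem_univ _), Finset.card_univ, hL.card_points] at this
  omega

/-- The truncated subtraction in `defect` loses nothing: the lines through `Q` carry `n - 1` further
points each, and only `n ^ 2 - 1` are available. -/
theorem valency_add_defect (hL : IsPartialAffine n L) (hn : 2 ≤ n) (Q : W) :
    valency L Q + defect n L Q = n + 1 := by
  have h := hL.card_unjoined_add Q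
  have : valency L Q ≤ n + 1 := by
    by_contra hc
    have h1 : (n + 2) * (n - 1) ≤ valency L Q * (n - 1) := Nat.mul_le_mul_right _ (by omega)
    obtain ⟨m, rfl⟩ : ∃ m, n = m + 1 := ⟨n - 1, by omega⟩
    have h2 : (m + 1) ^ 2 - 1 = m * m + 2 * m := by
      have : (m + 1) ^ 2 = m * m + 2 * m + 1 := by ring
      omega
    simp only [Nat.add_sub_cancel] at h1 h
    nlinarith
  unfold defect
  omega

theorem card_unjoined (hL : IsPartialAffine n L) (hn : 2 ≤ n) (Q : W) :
    (unjoined L Q).card = (n - 1) * defect n L Q := by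
  have h := hL.card_unjoined_add Q
  have h' := hL.valency_add_defect hn Q
  obtain ⟨m, rfl⟩ : ∃ m, n = m + 1 := ⟨n - 1, by omega⟩
  have h2 : (m + 1) ^ 2 - 1 = (m + 2) * m := by
    have : (m + 1) ^ 2 = (m + 2) * m + 1 := by ring
    omega
  have h3 : (valency L Q + defect (m + 1) L Q) * m = (m + 2) * m := by rw [h']
  simp only [Nat.add_sub_cancel] at h ⊢
  rw [h2, ← h3] at h
  linarith

/-- There are `n * L.card` incidences, against `n ^ 2 * (n + 1)` if every valency were `n + 1`. -/
theorem sum_defect (hL : IsPartialAffine n L) (hn : 2 ≤ n) {e : ℕ} (he : L.card + e = n ^ 2 + n) :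
    ∑ Q, defect n L Q = n * e := by
  have h1 : ∑ Q, valency L Q = n * L.card := by
    unfold valency blocksThrough
    rw [sum_card_filter_mem, Finset.sum_const_nat (m := n), mul_comm]
    intro l hl
    rw [← hL.card_line l hl]
    congr 1
    ext; simp
  have h2 : ∑ Q, (valency L Q + defect n L Q) = n ^ 2 * (n + 1) := by
    rw [Finset.sum_congr rfl (fun Q _ => hL.valency_add_defect hn Q)]
    simp [hL.card_points]
  rw [Finset.sum_add_distrib, h1] at h2
  have h3 : n * (L.card + e) = n ^ 2 * (n + 1) := by rw [he]; ring
  linarith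

theorem card_le (hL : IsPartialAffine n L) (hn : 2 ≤ n) : L.card ≤ n ^ 2 + n := by
  have h1 : ∑ Q, valency L Q = n * L.card := by
    unfold valency blocksThrough
    rw [sum_card_filter_mem, Finset.sum_const_nat (m := n), mul_comm]
    intro l hl
    rw [← hL.card_line l hl]
    congr 1
    ext; simp
  have h2 : ∑ Q, (valency L Q + defect n L Q) = n ^ 2 * (n + 1) := by
    rw [Finset.sum_congr rfl (fun Q _ => hL.valency_add_defect hn Q)]
    simp [hL.card_points]
  rw [Finset.sum_add_distrib, h1] at h2
  have h3 : n * L.card ≤ n * (n ^ 2 + n) := by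
    have : n * (n ^ 2 + n) = n ^ 2 * (n + 1) := by ring
    omega
  exact Nat.le_of_mul_le_mul_left h3 (by omega)

/-- The lines through `Q` that meet `l` correspond to the points of `l` joined to `Q`. This identity
is the main tool below: an excess of disjoint lines through `Q` is paid for by points of `l`
unjoined to `Q`. -/
theorem card_disjointLinesThrough (hL : IsPartialAffine n L) (hn : 2 ≤ n) {Q : W} {l : Finset W}
    (hl : l ∈ L) (hQ : Q ∉ l) :
    (disjointLinesThrough L Q l).card + defect n L Q = 1 + (unjoined L Q ∩ l).card := by
  have h1 : ((blocksThrough L Q).filter (fun m => ¬ Disjoint m l)).card =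
      (l \ unjoined L Q).card := by
    symm
    have hex : ∀ R ∈ l \ unjoined L Q, ∃ m ∈ L, Q ∈ m ∧ R ∈ m := by
      intro R hR
      rw [Finset.mem_sdiff] at hR
      exact exists_line_of_notMem_unjoined (fun h => hQ (h ▸ hR.1)) hR.2
    choose! f hfL hfQ hfR using hex
    refine Finset.card_bij (fun R _ => f R) ?_ ?_ ?_
    · intro R hR
      rw [Finset.mem_filter, mem_blocksThrough]
      refine ⟨⟨hfL R hR, hfQ R hR⟩, ?_⟩
      rw [Finset.not_disjoint_iff]
      exact ⟨R, hfR R hR, (Finset.mem_sdiff.1 hR).1⟩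
    · intro R hR S hS h
      refine hL.eq_of_inter (hfL R hR) hl ?_ (hfR R hR) (Finset.mem_sdiff.1 hR).1 ?_
        (Finset.mem_sdiff.1 hS).1
      · rintro h'
        exact hQ (h' ▸ hfQ R hR)
      · rw [show f R = f S from h]
        exact hfR S hS
    · intro m hm
      rw [Finset.mem_filter, mem_blocksThrough, Finset.not_disjoint_iff] at hm
      obtain ⟨⟨hmL, hQm⟩, R, hRm, hRl⟩ := hm
      have hRQ : R ≠ Q := fun h => hQ (h ▸ hRl)
      have hR : R ∈ l \ unjoined L Q := by
        rw [Finset.mem_sdiff, mem_unjoined]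
        exact ⟨hRl, fun h => h.2 m hmL ⟨hQm, hRm⟩⟩
      exact ⟨R, hR, hL.eq_of_mem _ (hfL R hR) _ hmL Q R hRQ.symm (hfQ R hR) (hfR R hR) hQm hRm⟩
  have h2 := Finset.card_filter_add_card_filter_not (s := blocksThrough L Q)
    (fun m => Disjoint m l)
  have h3 : (blocksThrough L Q).filter (fun m => Disjoint m l) = disjointLinesThrough L Q l := by
    ext m
    simp [mem_blocksThrough, mem_disjointLinesThrough, and_assoc]
  have h4 := Finset.card_sdiff_add_card_inter l (unjoined L Q)
  have h5 := hL.valency_add_defect hn Q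
  rw [hL.card_line l hl, Finset.inter_comm] at h4
  rw [h3, h1] at h2
  unfold valency at h5
  omega

/-- Every other line that meets `l` does so in one point, and a point `Q` of `l` lies on `n - defect
n L Q` lines besides `l`. -/
theorem card_disjointLines (hL : IsPartialAffine n L) (hn : 2 ≤ n) {e : ℕ}
    (he : L.card + e = n ^ 2 + n) {l : Finset W} (hl : l ∈ L) :
    (disjointLines L l).card + e + 1 = n + ∑ Q ∈ l, defect n L Q := by
  have hne : l.Nonempty := Finset.card_pos.1 (by rw [hL.card_line l hl]; omega)
  have h1 : ∑ Q ∈ l, ((L.erase l).filter (fun m => Q ∈ m)).card =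
      ((L.erase l).filter (fun m => ¬ Disjoint m l)).card := by
    rw [sum_card_filter_mem, Finset.card_filter]
    refine Finset.sum_congr rfl fun m hm => ?_
    rw [Finset.mem_erase] at hm
    by_cases h : Disjoint m l
    · rw [if_neg (not_not.2 h), Finset.card_eq_zero, Finset.filter_eq_empty_iff]
      intro Q hQ hQm
      exact Finset.disjoint_left.1 h hQm hQ
    · rw [if_pos h, Finset.card_eq_one]
      rw [Finset.not_disjoint_iff] at h
      obtain ⟨R, hRm, hRl⟩ := h
      refine ⟨R, ?_⟩
      ext S
      simp only [Finset.mem_filter, Finset.mem_singleton]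
      refine ⟨fun hS => hL.eq_of_inter hm.2 hl hm.1 hS.2 hS.1 hRm hRl, ?_⟩
      rintro rfl
      exact ⟨hRl, hRm⟩
  have h2 : ∑ Q ∈ l, (((L.erase l).filter (fun m => Q ∈ m)).card + defect n L Q) = n * n := by
    rw [Finset.sum_const_nat (m := n), hL.card_line l hl]
    intro Q hQ
    have h3 := hL.valency_add_defect hn Q
    have h4 : (L.erase l).filter (fun m => Q ∈ m) = (blocksThrough L Q).erase l := by
      ext m
      simp [mem_blocksThrough, and_assoc]
    rw [h4, Finset.card_erase_of_mem (mem_blocksThrough.2 ⟨hl, hQ⟩)]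
    have : 0 < (blocksThrough L Q).card := Finset.card_pos.2 ⟨l, mem_blocksThrough.2 ⟨hl, hQ⟩⟩
    unfold valency at h3
    omega
  rw [Finset.sum_add_distrib, h1] at h2
  have h5 := Finset.card_filter_add_card_filter_not (s := L.erase l) (fun m => Disjoint m l)
  have h6 : (L.erase l).filter (fun m => Disjoint m l) = disjointLines L l := by
    ext m
    simp only [Finset.mem_filter, Finset.mem_erase, mem_disjointLines]
    refine ⟨fun h => ⟨h.1.2, h.2⟩, fun h => ⟨⟨?_, h.1⟩, h.2⟩⟩
    rintro rfl
    exact hne.ne_empty (disjoint_self.1 h.2)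
  rw [h6, Finset.card_erase_of_mem hl] at h5
  have : 0 < L.card := Finset.card_pos.2 ⟨l, hl⟩
  have : n ^ 2 = n * n := sq n
  omega

/-- A point of defect zero lies on exactly one line disjoint from a line not containing it. -/
theorem card_disjointLinesThrough_of_defect_eq_zero (hL : IsPartialAffine n L) (hn : 2 ≤ n) {Q : W}
    {l : Finset W} (hl : l ∈ L) (hQ : Q ∉ l) (hd : defect n L Q = 0) :
    (disjointLinesThrough L Q l).card = 1 := by
  have h := hL.card_disjointLinesThrough hn hl hQ
  have h1 := hL.card_unjoined hn Q
  rw [hd, mul_zero, Finset.card_eq_zero] at h1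
  rw [h1, hd] at h
  simpa using h

theorem exists_disjoint_of_defect_eq_zero (hL : IsPartialAffine n L) (hn : 2 ≤ n) {Q : W}
    {l : Finset W} (hl : l ∈ L) (hQ : Q ∉ l) (hd : defect n L Q = 0) :
    ∃ m ∈ L, Q ∈ m ∧ Disjoint m l := by
  have h := hL.card_disjointLinesThrough_of_defect_eq_zero hn hl hQ hd
  obtain ⟨m, hm⟩ := Finset.card_pos.1 (by omega : 0 < (disjointLinesThrough L Q l).card)
  exact ⟨m, mem_disjointLinesThrough.1 hm⟩

theorem eq_of_disjoint_of_defect_eq_zero (hL : IsPartialAffine n L) (hn : 2 ≤ n) {Q : W}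
    {l m m' : Finset W} (hl : l ∈ L) (hd : defect n L Q = 0) (hm : m ∈ L) (hm' : m' ∈ L)
    (hQm : Q ∈ m) (hQm' : Q ∈ m') (h : Disjoint m l) (h' : Disjoint m' l) : m = m' := by
  have hQ : Q ∉ l := fun hQ => Finset.disjoint_left.1 h hQm hQ
  have h1 := hL.card_disjointLinesThrough_of_defect_eq_zero hn hl hQ hd
  exact Finset.card_le_one.1 h1.le m (mem_disjointLinesThrough.2 ⟨hm, hQm, h⟩) m'
    (mem_disjointLinesThrough.2 ⟨hm', hQm', h'⟩)

theorem defect_pos_of_mem_unjoined (hL : IsPartialAffine n L) (hn : 2 ≤ n) {Q R : W}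
    (h : R ∈ unjoined L Q) : 0 < defect n L R := by
  have h1 := hL.card_unjoined hn R
  by_contra hc
  have h2 : defect n L R = 0 := by omega
  rw [h2, mul_zero, Finset.card_eq_zero] at h1
  have := unjoined_symm h
  rw [h1] at this
  simp at this

end IsPartialAffine

end Basic

/-! ### Completing by the stars of the points of defect one -/

section Completion

/-- Under transitivity of parallelism, disjoint lines through a point to a line coincide. -/
theorem eq_of_parallelismIsEquivalence {W : Type*} {L : Finset (Finset W)}
    (hp : ParallelismIsEquivalence L)
    {Q : W} {l m m' : Finset W} (hl : l ∈ L) (hm : m ∈ L) (hm' : m' ∈ L) (hQm : Q ∈ m) (hQm' : Q ∈ m')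
    (h : Parallel m l) (h' : Parallel m' l) : m = m' := by
  have h1 : Parallel m m' := hp.trans (x := ⟨m, hm⟩) (y := ⟨l, hl⟩) (z := ⟨m', hm'⟩) h
    (hp.symm (x := ⟨m', hm'⟩) (y := ⟨l, hl⟩) h')
  rcases h1 with h1 | h1
  · exact h1
  · exact (Finset.disjoint_left.1 h1 hQm hQm').elim

variable {W : Type*} [Fintype W] [DecidableEq W]

/-- The set `M` of new lines completes `L` to an affine plane of order `n`. -/
structure IsCompletion (n : ℕ) (L M : Finset (Finset W)) : Prop where
  disjoint : Disjoint L M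
  card_line : ∀ b ∈ M, b.card = n
  existsUnique : ∀ Q R, Q ≠ R → ∃! b, b ∈ L ∪ M ∧ Q ∈ b ∧ R ∈ b

/-- The point `Q` together with all points not joined to it. -/
def closedStar (L : Finset (Finset W)) (Q : W) : Finset W := insert Q (unjoined L Q)

variable {n : ℕ} {L M : Finset (Finset W)}

theorem mem_closedStar {Q R : W} : R ∈ closedStar L Q ↔ R = Q ∨ R ∈ unjoined L Q := by
  simp [closedStar]

theorem self_mem_closedStar (Q : W) : Q ∈ closedStar L Q := Finset.mem_insert_self _ _

theorem IsPartialAffine.card_closedStar (hL : IsPartialAffine n L) (hn : 2 ≤ n) {Q : W}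
    (hd : defect n L Q = 1) : (closedStar L Q).card = n := by
  rw [closedStar, Finset.card_insert_of_notMem self_notMem_unjoined, hL.card_unjoined hn, hd]
  omega

theorem IsCompletion.isPartialAffine (hM : IsCompletion n L M) (hL : IsPartialAffine n L) :
    IsPartialAffine n (L ∪ M) where
  card_points := hL.card_points
  card_line l hl := (Finset.mem_union.1 hl).elim (hL.card_line l) (hM.card_line l)
  eq_of_mem _ hl _ hm Q R hne h1 h2 h3 h4 :=
    (hM.existsUnique Q R hne).unique ⟨hl, h1, h2⟩ ⟨hm, h3, h4⟩

theorem IsCompletion.defect_union (hM : IsCompletion n L M) (hL : IsPartialAffine n L)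
    (hn : 2 ≤ n) (Q : W) : defect n (L ∪ M) Q = 0 := by
  have h := (hM.isPartialAffine hL).card_unjoined hn Q
  have h1 : unjoined (L ∪ M) Q = ∅ := by
    rw [Finset.eq_empty_iff_forall_notMem]
    intro R hR
    rw [mem_unjoined] at hR
    obtain ⟨b, hb, -⟩ := hM.existsUnique Q R hR.1.symm
    exact hR.2 b hb.1 hb.2
  rw [h1, Finset.card_empty] at h
  rcases Nat.mul_eq_zero.1 h.symm with h | h
  · omega
  · exact h

theorem IsCompletion.valency_eq (hM : IsCompletion n L M) (hL : IsPartialAffine n L)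
    (hn : 2 ≤ n) (Q : W) : valency M Q = defect n L Q := by
  have h1 := (hM.isPartialAffine hL).valency_add_defect hn Q
  have h2 := hL.valency_add_defect hn Q
  rw [hM.defect_union hL hn] at h1
  have h3 : valency (L ∪ M) Q = valency L Q + valency M Q := by
    unfold valency blocksThrough
    rw [Finset.filter_union, Finset.card_union_of_disjoint]
    exact Finset.disjoint_filter_filter hM.disjoint
  omega

theorem IsCompletion.card_eq (hM : IsCompletion n L M) (hL : IsPartialAffine n L)
    (hn : 2 ≤ n) {e : ℕ} (he : L.card + e = n ^ 2 + n) : M.card = e := by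
  have hA := hM.isPartialAffine hL
  have h1 := hA.card_le hn
  have h2 := hA.sum_defect hn (e := n ^ 2 + n - (L ∪ M).card) (by omega)
  rw [Finset.sum_eq_zero (fun Q _ => hM.defect_union hL hn Q)] at h2
  have h3 := Finset.card_union_of_disjoint hM.disjoint
  rcases Nat.mul_eq_zero.1 h2.symm with h | h <;> omega

namespace IsPartialAffine

/-- The points not joined to a point of defect one are pairwise not joined, provided that there is
at most one disjoint line through it to each line. -/
theorem mem_unjoined_of_mem_closedStar {Q R S : W}
    (h : ∀ l ∈ L, Q ∉ l → (unjoined L Q ∩ l).card ≤ 1) (hR : R ∈ closedStar L Q) (hS : S ∈ closedStar L Q)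
    (hne : S ≠ R) : S ∈ unjoined L R := by
  rw [mem_closedStar] at hR hS
  rcases hR with rfl | hR
  · exact hS.resolve_left hne
  rcases hS with rfl | hS
  · exact unjoined_symm hR
  rw [mem_unjoined]
  refine ⟨hne, fun m hm hRS => ?_⟩
  have hQ : Q ∉ m := fun hQ => (mem_unjoined.1 hR).2 m hm ⟨hQ, hRS.1⟩
  exact hne (Finset.card_le_one.1 (h m hm hQ) S (Finset.mem_inter.2 ⟨hS, hRS.2⟩) R
    (Finset.mem_inter.2 ⟨hR, hRS.1⟩))

/-- The points of the star of `Q` are pairwise unjoined, so they all lie in the star of `R`, and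
both stars have `n` points. -/
theorem closedStar_eq_of_mem (hL : IsPartialAffine n L) (hn : 2 ≤ n) {Q R : W}
    (h : ∀ l ∈ L, Q ∉ l → (unjoined L Q ∩ l).card ≤ 1) (hQ : defect n L Q = 1)
    (hR : defect n L R = 1) (hRQ : R ∈ closedStar L Q) : closedStar L Q = closedStar L R := by
  refine Finset.eq_of_subset_of_card_le ?_ (by rw [hL.card_closedStar hn hQ, hL.card_closedStar hn hR])
  intro S hS
  rw [mem_closedStar]
  by_cases hSR : S = R
  · exact Or.inl hSR
  · exact Or.inr (mem_unjoined_of_mem_closedStar h hRQ hS hSR)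

/-- The stars of the points of defect one complete a partial affine plane if they share at most one
point pairwise and few points have defect at least two. -/
theorem exists_isCompletion (hL : IsPartialAffine n L) (hn : 2 ≤ n)
    (h1 : ∀ Q, defect n L Q = 1 → ∀ l ∈ L, Q ∉ l → (unjoined L Q ∩ l).card ≤ 1)
    (h2 : ∀ Q Q' R S, defect n L Q = 1 → defect n L Q' = 1 → R ≠ S → R ∈ closedStar L Q → S ∈ closedStar L Q →
      R ∈ closedStar L Q' → S ∈ closedStar L Q' → closedStar L Q = closedStar L Q')
    (h3 : (Finset.univ.filter (fun Q => 2 ≤ defect n L Q)).card < n) :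
    ∃ M, IsCompletion n L M := by
  set M := (Finset.univ.filter (fun Q => defect n L Q = 1)).image (closedStar L) with hM
  have hmem : ∀ b, b ∈ M ↔ ∃ Q, defect n L Q = 1 ∧ closedStar L Q = b := by
    intro b
    simp [hM]
  have hcard : ∀ b ∈ M, b.card = n := by
    intro b hb
    obtain ⟨Q, hQ, rfl⟩ := (hmem b).1 hb
    exact hL.card_closedStar hn hQ
  have hnot : ∀ l ∈ L, ∀ m ∈ M, ∀ Q R, Q ≠ R → Q ∈ l → R ∈ l → Q ∈ m → R ∈ m → False := by
    intro l hl m hm Q R hne hQl hRl hQm hRm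
    obtain ⟨P, hP, rfl⟩ := (hmem m).1 hm
    exact (mem_unjoined.1 (mem_unjoined_of_mem_closedStar (h1 P hP) hQm hRm hne.symm)).2 l hl ⟨hQl, hRl⟩
  have hA : IsPartialAffine n (L ∪ M) := by
    refine ⟨hL.card_points, fun l hl => (Finset.mem_union.1 hl).elim (hL.card_line l) (hcard l), ?_⟩
    intro l hl m hm Q R hne hQl hRl hQm hRm
    rcases Finset.mem_union.1 hl with hl | hl <;> rcases Finset.mem_union.1 hm with hm | hm
    · exact hL.eq_of_mem l hl m hm Q R hne hQl hRl hQm hRm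
    · exact (hnot l hl m hm Q R hne hQl hRl hQm hRm).elim
    · exact (hnot m hm l hl Q R hne hQm hRm hQl hRl).elim
    · obtain ⟨P, hP, rfl⟩ := (hmem l).1 hl
      obtain ⟨P', hP', rfl⟩ := (hmem m).1 hm
      exact h2 P P' Q R hP hP' hne hQl hRl hQm hRm
  have hdisj : Disjoint L M := by
    rw [Finset.disjoint_left]
    intro b hb hb'
    obtain ⟨Q, hQ, R, hR, hne⟩ := Finset.one_lt_card.1 (by rw [hcard b hb']; omega : 1 < b.card)
    exact hnot b hb b hb' Q R hne hQ hR hQ hR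
  have hun : ∀ Z, unjoined (L ∪ M) Z = ∅ := by
    intro Z
    by_contra hZ
    have hZ1 : 0 < (unjoined (L ∪ M) Z).card :=
      Finset.card_pos.2 (Finset.nonempty_iff_ne_empty.2 hZ)
    have hZ2 := hA.card_unjoined hn Z
    have hZ3 : 1 ≤ defect n (L ∪ M) Z := by
      by_contra hc
      have : defect n (L ∪ M) Z = 0 := by omega
      rw [this] at hZ2
      omega
    -- A point of defect one is joined to all others by lines of `L` and by its own star. So only
    -- points of larger defect can be left unjoined, and the star of such a `Z` in `L ∪ M` would
    -- contain at least `n` of them.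
    have hsub : closedStar (L ∪ M) Z ⊆ Finset.univ.filter (fun Q => 2 ≤ defect n L Q) := by
      intro R hR
      have hRne : (unjoined (L ∪ M) R).Nonempty := by
        rcases mem_closedStar.1 hR with rfl | hR
        · exact Finset.card_pos.1 hZ1
        · exact ⟨Z, unjoined_symm hR⟩
      obtain ⟨S, hS⟩ := hRne
      rw [mem_unjoined] at hS
      have hSL : S ∈ unjoined L R :=
        mem_unjoined.2 ⟨hS.1, fun l hl => hS.2 l (Finset.mem_union_left _ hl)⟩
      have hpos := hL.defect_pos_of_mem_unjoined hn (unjoined_symm hSL)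
      rw [Finset.mem_filter]
      refine ⟨Finset.mem_univ _, ?_⟩
      by_contra hc
      have h1R : defect n L R = 1 := by omega
      exact hS.2 (closedStar L R) (Finset.mem_union_right _ ((hmem _).2 ⟨R, h1R, rfl⟩))
        ⟨self_mem_closedStar R, mem_closedStar.2 (Or.inr hSL)⟩
    have h4 := Finset.card_le_card hsub
    rw [closedStar, Finset.card_insert_of_notMem self_notMem_unjoined, hZ2] at h4
    have h5 : (n - 1) * 1 ≤ (n - 1) * defect n (L ∪ M) Z := Nat.mul_le_mul_left _ hZ3
    omega
  refine ⟨M, hdisj, hcard, ?_⟩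
  intro Q R hne
  have hR : R ∉ unjoined (L ∪ M) Q := by rw [hun]; simp
  obtain ⟨b, hb, hQ, hR⟩ := exists_line_of_notMem_unjoined hne.symm hR
  exact ⟨b, ⟨hb, hQ, hR⟩, fun b' hb' => hA.eq_of_mem b' hb'.1 b hb Q R hne hb'.2.1 hb'.2.2 hQ hR⟩

/-- Completion when at most one point has defect at least two. -/
theorem exists_isCompletion_of_defect_le_one (hL : IsPartialAffine n L) (hn : 2 ≤ n)
    (h1 : ∀ Q, defect n L Q = 1 → ∀ l ∈ L, Q ∉ l → (unjoined L Q ∩ l).card ≤ 1)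
    (h2 : ∀ Q R, 2 ≤ defect n L Q → 2 ≤ defect n L R → Q = R) :
    ∃ M, IsCompletion n L M := by
  refine hL.exists_isCompletion hn h1 ?_ ?_
  -- Stars sharing a point of defect one both equal the star of that point; of two common points, at
  -- most one has larger defect.
  · have key : ∀ Q Q' R, defect n L Q = 1 → defect n L Q' = 1 → R ∈ closedStar L Q → R ∈ closedStar L Q' →
        ¬ 2 ≤ defect n L R → closedStar L Q = closedStar L Q' := by
      intro Q Q' R hQ hQ' hR hR' hd
      have hd1 : defect n L R = 1 := by
        rcases mem_closedStar.1 hR with rfl | hR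
        · exact hQ
        · have := hL.defect_pos_of_mem_unjoined hn hR
          omega
      rw [hL.closedStar_eq_of_mem hn (h1 Q hQ) hQ hd1 hR, hL.closedStar_eq_of_mem hn (h1 Q' hQ') hQ' hd1 hR']
    intro Q Q' R S hQ hQ' hne hRQ hSQ hRQ' hSQ'
    by_cases hR : 2 ≤ defect n L R
    · refine key Q Q' S hQ hQ' hSQ hSQ' fun hS => hne (h2 R S hR hS)
    · exact key Q Q' R hQ hQ' hRQ hRQ' hR
  · refine lt_of_le_of_lt (Finset.card_le_one.2 ?_) (by omega : 1 < n)
    intro Q hQ R hR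
    exact h2 Q R (Finset.mem_filter.1 hQ).2 (Finset.mem_filter.1 hR).2

/-- If lines through `Q` disjoint from a common line coincide, then each line meets the set of points
not joined to `Q` at most in one point. -/
theorem card_unjoined_inter_le_one (hL : IsPartialAffine n L) (hn : 2 ≤ n) {Q : W} {l : Finset W}
    (hl : l ∈ L) (hQ : Q ∉ l) (hd : defect n L Q = 1)
    (h : ∀ m ∈ L, ∀ m' ∈ L, Q ∈ m → Q ∈ m' → Disjoint m l → Disjoint m' l → m = m') :
    (unjoined L Q ∩ l).card ≤ 1 := by
  have h1 := hL.card_disjointLinesThrough hn hl hQ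
  have h2 : (disjointLinesThrough L Q l).card ≤ 1 := by
    rw [Finset.card_le_one]
    intro m hm m' hm'
    rw [mem_disjointLinesThrough] at hm hm'
    exact h m hm.1 m' hm'.1 hm.2.1 hm'.2.1 hm.2.2 hm'.2.2
  omega

theorem exists_isCompletion_of_equivalence_of_valency (hL : IsPartialAffine n L) (hn : 2 ≤ n)
    (hp : ParallelismIsEquivalence L)
    (h : ∀ Q R, valency L Q < n → valency L R < n → Q = R) : ∃ M, IsCompletion n L M := by
  refine hL.exists_isCompletion_of_defect_le_one hn ?_ ?_
  · intro Q hQ l hl hQl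
    exact hL.card_unjoined_inter_le_one hn hl hQl hQ fun m hm m' hm' hQm hQm' hd hd' =>
      eq_of_parallelismIsEquivalence hp hl hm hm' hQm hQm' (Or.inr hd) (Or.inr hd')
  · intro Q R hQ hR
    have h1 := hL.valency_add_defect hn Q
    have h2 := hL.valency_add_defect hn R
    exact h Q R (by omega) (by omega)

end IsPartialAffine

end Completion

/-! ### Parallelism as an equivalence relation, with many lines -/

section ParallelClasses

variable {W : Type*} [Fintype W] [DecidableEq W] {n : ℕ} {L : Finset (Finset W)}

namespace IsPartialAffine

/-- A point of defect zero yields representatives of the parallel classes. -/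
theorem exists_parallel_representative (hL : IsPartialAffine n L) (hn : 2 ≤ n)
    (hp : ParallelismIsEquivalence L) {Z : W} (hZ : defect n L Z = 0) :
    ∃ z : Finset W → Finset W, (∀ l ∈ L, z l ∈ blocksThrough L Z) ∧
      ∀ l ∈ L, ∀ m ∈ L, (z l = z m ↔ Parallel l m) := by
  have hex : ∀ l ∈ L, ∃ z ∈ L, Z ∈ z ∧ Parallel z l := by
    intro l hl
    by_cases hZl : Z ∈ l
    · exact ⟨l, hl, hZl, Or.inl rfl⟩
    · obtain ⟨m, hm, hZm, hd⟩ := hL.exists_disjoint_of_defect_eq_zero hn hl hZl hZ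
      exact ⟨m, hm, hZm, Or.inr hd⟩
  choose! z hzL hZz hpar using hex
  refine ⟨z, fun l hl => mem_blocksThrough.2 ⟨hzL l hl, hZz l hl⟩, fun l hl m hm => ?_⟩
  constructor
  · intro h
    exact hp.trans (x := ⟨l, hl⟩) (y := ⟨z l, hzL l hl⟩) (z := ⟨m, hm⟩)
      (hp.symm (x := ⟨z l, hzL l hl⟩) (y := ⟨l, hl⟩) (hpar l hl))
      (show Parallel (z l) m by rw [h]; exact hpar m hm)
  · intro h
    exact eq_of_parallelismIsEquivalence hp hm (hzL l hl) (hzL m hm) (hZz l hl) (hZz m hm)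
      (hp.trans (x := ⟨z l, hzL l hl⟩) (y := ⟨l, hl⟩) (z := ⟨m, hm⟩) (hpar l hl) h) (hpar m hm)

/-- Two distinct stars of points of defect one share at most one point, if there are `n + 1`
parallel classes. -/
theorem closedStar_eq_of_two_common (hL : IsPartialAffine n L) (hn : 2 ≤ n)
    (hp : ParallelismIsEquivalence L)
    (h1 : ∀ Q, defect n L Q = 1 → ∀ l ∈ L, Q ∉ l → (unjoined L Q ∩ l).card ≤ 1)
    {Z : W} (hZ : defect n L Z = 0) {Q Q' R S : W} (hQ : defect n L Q = 1)
    (hQ' : defect n L Q' = 1) (hRS : R ≠ S) (hRQ : R ∈ closedStar L Q) (hSQ : S ∈ closedStar L Q)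
    (hRQ' : R ∈ closedStar L Q') (hSQ' : S ∈ closedStar L Q') :
    closedStar L Q = closedStar L Q' := by
  by_contra hne
  obtain ⟨z, hzB, hz⟩ := hL.exists_parallel_representative hn hp hZ
  have hnot : Q' ∉ closedStar L Q := fun h => hne (hL.closedStar_eq_of_mem hn (h1 Q hQ) hQ hQ' h)
  have hnot' : Q ∉ closedStar L Q' := fun h =>
    hne (hL.closedStar_eq_of_mem hn (h1 Q' hQ') hQ' hQ h).symm
  have hQQ' : Q' ≠ Q := by
    rintro rfl
    exact hne rfl
  obtain ⟨m, hm, hQm, hQ'm⟩ :=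
    exists_line_of_notMem_unjoined hQQ' (fun h => hnot (mem_closedStar.2 (Or.inr h)))
  have huniq : ∀ h ∈ L, Q ∈ h → Q' ∈ h → h = m := fun h hh h1 h2 =>
    hL.eq_of_mem h hh m hm Q Q' hQQ'.symm h1 h2 hQm hQ'm
  have hB : ∀ P, defect n L P = 1 → ((blocksThrough L P).image z).card = n := by
    intro P hP
    rw [Finset.card_image_of_injOn]
    · have := hL.valency_add_defect hn P
      unfold valency at this
      omega
    · intro l hl l' hl' h
      rw [Finset.mem_coe, mem_blocksThrough] at hl hl'
      exact eq_of_parallelismIsEquivalence hp hl'.1 hl.1 hl'.1 hl.2 hl'.2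
        ((hz l hl.1 l' hl'.1).1 h) (Or.inl rfl)
  set T := (((blocksThrough L Q).image z) ∩ ((blocksThrough L Q').image z)).erase (z m) with hT
  -- Each of `Q` and `Q'` is missed by just one of the `n + 1` classes, so at least `n - 1` classes
  -- have lines through both; the class of the joining line `m` is discarded.
  have hTcard : n - 2 ≤ T.card := by
    have h2 := Finset.card_inter_add_card_union ((blocksThrough L Q).image z)
      ((blocksThrough L Q').image z)
    have h3 : ((blocksThrough L Q).image z ∪ (blocksThrough L Q').image z).card ≤ n + 1 := by
      have h4 := hL.valency_add_defect hn Z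
      rw [hZ, add_zero] at h4
      rw [← h4, valency]
      refine Finset.card_le_card (Finset.union_subset ?_ ?_) <;>
      · intro t ht
        obtain ⟨l, hl, rfl⟩ := Finset.mem_image.1 ht
        exact hzB l (mem_blocksThrough.1 hl).1
    rw [hB Q hQ, hB Q' hQ'] at h2
    have h5 := Finset.pred_card_le_card_erase (s := ((blocksThrough L Q).image z) ∩
      ((blocksThrough L Q').image z)) (a := z m)
    rw [← hT] at h5
    omega
  -- The lines of class `t` through `Q` and `Q'` are disjoint. As `Q` has defect one, the line
  -- through `Q'` must contain a point `X` unjoined to `Q`. Different classes give different `X`, so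
  -- at least `n - 2` of the `n - 1` points unjoined to `Q` are joined to `Q'`, which leaves room
  -- for at most one common point.
  have hex : ∀ t ∈ T, ∃ X ∈ unjoined L Q, ∃ h ∈ L, z h = t ∧ Q' ∈ h ∧ X ∈ h := by
    intro t ht
    rw [hT, Finset.mem_erase, Finset.mem_inter, Finset.mem_image, Finset.mem_image] at ht
    obtain ⟨htm, ⟨g, hg, hgt⟩, h, hh, hht⟩ := ht
    rw [mem_blocksThrough] at hg hh
    have hQh : Q ∉ h := fun hQh => htm (by rw [← hht, huniq h hh.1 hQh hh.2])
    have hgh : Disjoint g h := ((hz g hg.1 h hh.1).1 (hgt.trans hht.symm)).resolve_left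
      (fun e => hQh (e ▸ hg.2))
    have h2 := hL.card_disjointLinesThrough hn hh.1 hQh
    have h3 : 0 < (disjointLinesThrough L Q h).card :=
      Finset.card_pos.2 ⟨g, mem_disjointLinesThrough.2 ⟨hg.1, hg.2, hgh⟩⟩
    obtain ⟨X, hX⟩ := Finset.card_pos.1 (by omega : 0 < (unjoined L Q ∩ h).card)
    rw [Finset.mem_inter] at hX
    exact ⟨X, hX.1, h, hh.1, hht, hh.2, hX.2⟩
  have : Nonempty W := ⟨Q⟩
  choose! φ hφ1 line hline hzline hQ'line hφline using hex
  have hφne : ∀ t ∈ T, Q' ≠ φ t := fun t ht h => hnot (mem_closedStar.2 (Or.inr (h ▸ hφ1 t ht)))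
  have hle : T.card ≤ (unjoined L Q \ unjoined L Q').card := by
    refine Finset.card_le_card_of_injOn φ ?_ ?_
    · intro t ht
      rw [Finset.mem_coe, Finset.mem_sdiff]
      exact ⟨hφ1 t ht, fun h => (mem_unjoined.1 h).2 _ (hline t ht) ⟨hQ'line t ht, hφline t ht⟩⟩
    · intro t ht t' ht' h
      rw [← hzline t ht, ← hzline t' ht']
      congr 1
      exact hL.eq_of_mem _ (hline t ht) _ (hline t' ht') Q' (φ t) (hφne t ht) (hQ'line t ht)
        (hφline t ht) (hQ'line t' ht') (h ▸ hφline t' ht')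
  have h6 := Finset.card_sdiff_add_card_inter (unjoined L Q) (unjoined L Q')
  rw [hL.card_unjoined hn, hQ] at h6
  have hin : ∀ X, X ∈ closedStar L Q → X ∈ closedStar L Q' → X ∈ unjoined L Q ∩ unjoined L Q' := by
    intro X hX hX'
    rw [Finset.mem_inter]
    exact ⟨(mem_closedStar.1 hX).resolve_left (fun h => hnot' (h ▸ hX')),
      (mem_closedStar.1 hX').resolve_left (fun h => hnot (h ▸ hX))⟩
  have h7 : 1 < (unjoined L Q ∩ unjoined L Q').card :=
    Finset.one_lt_card.2 ⟨R, hin R hRQ hRQ', S, hin S hSQ hSQ', hRS⟩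
  omega

/-- Summing the class size of each line over `L` gives the sum of the squares of the `n + 1` class
sizes, which Cauchy-Schwarz bounds from below. By `card_disjointLines` the same sum is an expression
in which the squares of the defects enter negatively. -/
theorem sum_defect_sq_le (hL : IsPartialAffine n L) (hn : 2 ≤ n)
    (hp : ParallelismIsEquivalence L) {e : ℕ} (he : L.card + e = n ^ 2 + n)
    {Z : W} (hZ : defect n L Z = 0) :
    ∑ Q, defect n L Q ^ 2 ≤ n * e + e ^ 2 := by
  obtain ⟨z, hzB, hz⟩ := hL.exists_parallel_representative hn hp hZ
  have hfib : ∀ l ∈ L, (L.filter (fun m => z m = z l)).card = (disjointLines L l).card + 1 := by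
    intro l hl
    have : L.filter (fun m => z m = z l) = insert l (disjointLines L l) := by
      ext m
      rw [Finset.mem_filter, Finset.mem_insert, mem_disjointLines]
      constructor
      · rintro ⟨hm, h⟩
        rcases (hz m hm l hl).1 h with h | h
        · exact Or.inl h
        · exact Or.inr ⟨hm, h⟩
      · rintro (rfl | ⟨hm, h⟩)
        · exact ⟨hl, rfl⟩
        · exact ⟨hm, (hz m hm l hl).2 (Or.inr h)⟩
    rw [this, Finset.card_insert_of_notMem]
    intro h
    have h1 := disjoint_self.1 (mem_disjointLines.1 h).2
    have h2 := hL.card_line l hl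
    rw [h1] at h2
    simp at h2
    omega
  have hsum : ∑ l ∈ L, (L.filter (fun m => z m = z l)).card =
      ∑ t ∈ blocksThrough L Z, (L.filter (fun m => z m = t)).card ^ 2 := by
    rw [← Finset.sum_fiberwise_of_maps_to hzB]
    refine Finset.sum_congr rfl fun t _ => ?_
    rw [Finset.sum_const_nat (m := (L.filter (fun m => z m = t)).card), sq]
    intro l hl
    rw [(Finset.mem_filter.1 hl).2]
  have hcs := sq_sum_le_card_mul_sum_sq (s := blocksThrough L Z)
    (f := fun t => (L.filter (fun m => z m = t)).card)
  rw [← hsum, ← Finset.card_eq_sum_card_fiberwise hzB] at hcs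
  have hZv : (blocksThrough L Z).card = n + 1 := by
    have := hL.valency_add_defect hn Z
    rwa [hZ, add_zero] at this
  rw [hZv] at hcs
  set c := ∑ l ∈ L, (L.filter (fun m => z m = z l)).card with hc
  have h2 : c + L.card * e = L.card * n + ∑ l ∈ L, ∑ Q ∈ l, defect n L Q := by
    rw [hc, ← smul_eq_mul, ← smul_eq_mul, ← Finset.sum_const, ← Finset.sum_const,
      ← Finset.sum_add_distrib, ← Finset.sum_add_distrib]
    refine Finset.sum_congr rfl fun l hl => ?_
    rw [hfib l hl, ← hL.card_disjointLines hn he hl]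
    ring
  have h3 : ∑ l ∈ L, ∑ Q ∈ l, defect n L Q + ∑ Q, defect n L Q ^ 2 = (n + 1) * (n * e) := by
    have h4 := sum_valency_mul Finset.univ L (defect n L)
    simp only [Finset.filter_univ_mem] at h4
    rw [← h4, ← Finset.sum_add_distrib, ← hL.sum_defect hn he, Finset.mul_sum]
    refine Finset.sum_congr rfl fun Q _ => ?_
    rw [← hL.valency_add_defect hn Q]
    unfold valency blocksThrough
    ring
  set S := ∑ Q, defect n L Q ^ 2
  set k := ∑ l ∈ L, ∑ Q ∈ l, defect n L Q
  have h5 : (n + 1) * S ≤ (n + 1) * (n * e + e ^ 2) := by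
    zify at *
    have hLc : (L.card : ℤ) = n ^ 2 + n - e := by linarith
    rw [hLc] at hcs h2
    have hSc : (S : ℤ) = (n + 1) * (n * e) - (c + (n ^ 2 + n - e) * e - (n ^ 2 + n - e) * n) := by
      linarith
    rw [hSc]
    nlinarith [sq_nonneg (e : ℤ)]
  exact Nat.le_of_mul_le_mul_left h5 (by omega)

theorem exists_isCompletion_of_equivalence_of_card (hL : IsPartialAffine n L) (hn : 2 ≤ n)
    (hp : ParallelismIsEquivalence L) {e : ℕ} (he : L.card + e = n ^ 2 + n) (hen : e ^ 2 ≤ n) :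
    ∃ M, IsCompletion n L M := by
  have hlt : e < n := by nlinarith
  obtain ⟨Z, hZ⟩ : ∃ Z, defect n L Z = 0 := by
    by_contra hc
    push Not at hc
    have h1 : ∑ _Q : W, 1 ≤ ∑ Q, defect n L Q :=
      Finset.sum_le_sum fun Q _ => Nat.one_le_iff_ne_zero.2 (hc Q)
    rw [hL.sum_defect hn he] at h1
    simp only [Finset.sum_const, Finset.card_univ, hL.card_points, smul_eq_mul, mul_one] at h1
    nlinarith
  have h1 : ∀ Q, defect n L Q = 1 → ∀ l ∈ L, Q ∉ l → (unjoined L Q ∩ l).card ≤ 1 := by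
    intro Q hQ l hl hQl
    exact hL.card_unjoined_inter_le_one hn hl hQl hQ fun m hm m' hm' hQm hQm' hd hd' =>
      eq_of_parallelismIsEquivalence hp hl hm hm' hQm hQm' (Or.inr hd) (Or.inr hd')
  refine hL.exists_isCompletion hn h1 ?_ ?_
  · intro Q Q' R S hQ hQ' hne hRQ hSQ hRQ' hSQ'
    exact hL.closedStar_eq_of_two_common hn hp h1 hZ hQ hQ' hne hRQ hSQ hRQ' hSQ'
  · have h2 := hL.sum_defect_sq_le hn hp he hZ
    -- A number `d ≥ 2` satisfies `d ^ 2 ≥ d + 2`. Hence twice the number of points of defect at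
    -- least two is at most `e ^ 2 ≤ n`.
    have h3 : (Finset.univ.filter (fun Q => 2 ≤ defect n L Q)).card * 2 + ∑ Q, defect n L Q ≤
        ∑ Q, defect n L Q ^ 2 := by
      rw [Finset.card_filter, Finset.sum_mul, ← Finset.sum_add_distrib]
      refine Finset.sum_le_sum fun Q _ => ?_
      split_ifs with h
      · nlinarith
      · interval_cases defect n L Q <;> simp
    rw [hL.sum_defect hn he] at h3
    omega

end IsPartialAffine

end ParallelClasses

/-! ### The parallels of a line -/

section ParallelLines

variable {W : Type*} [DecidableEq W] {L : Finset (Finset W)}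

/-- The line `l` together with the lines disjoint from it. -/
def parallelLines (L : Finset (Finset W)) (l : Finset W) : Finset (Finset W) :=
  insert l (disjointLines L l)

theorem mem_parallelLines {l m : Finset W} :
    m ∈ parallelLines L l ↔ m = l ∨ (m ∈ L ∧ Disjoint m l) := by
  simp [parallelLines, mem_disjointLines]

theorem card_filter_defect_ne_zero {n : ℕ} {s : Finset W} (h : ∀ Q ∈ s, defect n L Q ≤ 1) :
    (s.filter (fun Q => defect n L Q ≠ 0)).card = ∑ Q ∈ s, defect n L Q := by
  rw [Finset.card_filter]
  refine Finset.sum_congr rfl fun Q hQ => ?_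
  have := h Q hQ
  split_ifs <;> omega

end ParallelLines

/-! ### Transitivity of parallelism by counting -/

section ParallelFamilies

variable {W : Type*} [Fintype W] [DecidableEq W] {n : ℕ} {L : Finset (Finset W)}

namespace IsPartialAffine

theorem card_parallelLines (hL : IsPartialAffine n L) (hn : 2 ≤ n) {e : ℕ}
    (he : L.card + e = n ^ 2 + n) {l : Finset W} (hl : l ∈ L) :
    (parallelLines L l).card + e = n + ∑ Q ∈ l, defect n L Q := by
  rw [← hL.card_disjointLines hn he hl, parallelLines, Finset.card_insert_of_notMem]
  · ring
  · intro h
    have h1 := disjoint_self.1 (mem_disjointLines.1 h).2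
    have h2 := hL.card_line l hl
    rw [h1] at h2
    simp at h2
    omega

theorem card_unjoined_inter_le (hL : IsPartialAffine n L) (hn : 2 ≤ n) {l : Finset W} (Q : W)
    (h : ∀ R ∈ l, defect n L R ≤ 1) : (unjoined L Q ∩ l).card ≤ ∑ R ∈ l, defect n L R := by
  rw [← card_filter_defect_ne_zero h]
  refine Finset.card_le_card fun R hR => ?_
  rw [Finset.mem_inter] at hR
  exact Finset.mem_filter.2 ⟨hR.2, (hL.defect_pos_of_mem_unjoined hn hR.1).ne'⟩

/-- If `y` is parallel to `g` but not to `f`, then few lines are parallel to both `f` and `g`. -/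
theorem card_parallelLines_inter_add_le (hL : IsPartialAffine n L) (hn : 2 ≤ n) {e k : ℕ}
    (he : L.card + e = n ^ 2 + n) {f g y : Finset W} (hf : f ∈ L) (hg : g ∈ L) (hy : y ∈ L)
    (hfk : ∑ Q ∈ f, defect n L Q = k) (hyk : ∑ Q ∈ y, defect n L Q = k)
    (hyd : ∀ Q ∈ y, defect n L Q ≤ 1) (hyg : y ∈ parallelLines L g) (hyf : y ∉ parallelLines L f) :
    (parallelLines L f ∩ parallelLines L g).card + e ≤ 2 * k := by
  have hex : ∀ Y ∈ y.filter (fun Q => ¬ defect n L Q ≠ 0), ∃ z ∈ parallelLines L f, Y ∈ z := by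
    intro Y hY
    rw [Finset.mem_filter, not_not] at hY
    by_cases hYf : Y ∈ f
    · exact ⟨f, mem_parallelLines.2 (Or.inl rfl), hYf⟩
    · obtain ⟨m, hm, hYm, hd⟩ := hL.exists_disjoint_of_defect_eq_zero hn hf hYf hY.2
      exact ⟨m, mem_parallelLines.2 (Or.inr ⟨hm, hd⟩), hYm⟩
  choose! z hz hYz using hex
  have hzL : ∀ Y ∈ y.filter (fun Q => ¬ defect n L Q ≠ 0), z Y ∈ L := by
    intro Y hY
    rcases mem_parallelLines.1 (hz Y hY) with h | h
    · rw [h]; exact hf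
    · exact h.1
  have hzy : ∀ Y ∈ y.filter (fun Q => ¬ defect n L Q ≠ 0), z Y ≠ y := by
    intro Y hY h
    exact hyf (h ▸ hz Y hY)
  -- Each of the `n - k` points of `y` of defect zero lies on a parallel of `f`. That line is
  -- different from `y`, hence not parallel to `g`, because `y` is the only parallel of `g` through
  -- the point.
  have hle : (y.filter (fun Q => ¬ defect n L Q ≠ 0)).card ≤
      (parallelLines L f \ parallelLines L g).card := by
    refine Finset.card_le_card_of_injOn z ?_ ?_
    · intro Y hY
      have hY' := (Finset.mem_filter.1 (Finset.mem_coe.1 hY))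
      rw [not_not] at hY'
      rw [Finset.mem_coe, Finset.mem_sdiff]
      refine ⟨hz Y hY, fun h => ?_⟩
      rcases mem_parallelLines.1 h with h | h
      · rcases mem_parallelLines.1 hyg with h' | h'
        · exact hzy Y hY (h.trans h'.symm)
        · exact Finset.disjoint_left.1 h'.2 hY'.1 (h ▸ hYz Y hY)
      · rcases mem_parallelLines.1 hyg with h' | h'
        · exact Finset.disjoint_left.1 h.2 (hYz Y hY) (h' ▸ hY'.1)
        · exact hzy Y hY (hL.eq_of_disjoint_of_defect_eq_zero hn hg hY'.2 h.1 h'.1 (hYz Y hY)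
            hY'.1 h.2 h'.2)
    · intro Y hY Y' hY' h
      exact hL.eq_of_inter hy (hzL Y hY) (hzy Y hY).symm (Finset.mem_filter.1 hY).1 (hYz Y hY)
        (Finset.mem_filter.1 hY').1 (h ▸ hYz Y' hY')
  have h1 := Finset.card_filter_add_card_filter_not (s := y) (fun Q => defect n L Q ≠ 0)
  rw [card_filter_defect_ne_zero hyd, hyk, hL.card_line y hy] at h1
  have h2 := Finset.card_sdiff_add_card_inter (parallelLines L f) (parallelLines L g)
  have h3 := hL.card_parallelLines hn he hf
  omega

/-- Lines parallel to `f` but not to `g` meet `g` in points of positive defect. -/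
theorem exists_mem_of_notMem_parallelLines (hL : IsPartialAffine n L) (hn : 2 ≤ n)
    {f g z : Finset W} (hf : f ∈ L) (hg : g ∈ L) (hgf : Disjoint g f)
    (hzf : z ∈ parallelLines L f) (hzg : z ∉ parallelLines L g) :
    z ∈ L ∧ Disjoint z f ∧ z ≠ g ∧ ∃ x ∈ z, x ∈ g ∧ defect n L x ≠ 0 := by
  rw [mem_parallelLines] at hzf hzg
  push Not at hzg
  rcases hzf with rfl | ⟨hz, hzf⟩
  · exact (hzg.2 hf hgf.symm).elim
  · refine ⟨hz, hzf, hzg.1, ?_⟩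
    obtain ⟨x, hxz, hxg⟩ := Finset.not_disjoint_iff.1 (hzg.2 hz)
    refine ⟨x, hxz, hxg, fun hx => hzg.1 ?_⟩
    exact hL.eq_of_disjoint_of_defect_eq_zero hn hf hx hz hg hxz hxg hzf hgf

/-- The lines counted meet `g` in one of its `k` points of positive defect, and each such point lies
on at most `k` lines disjoint from `f`, one of which is `g`. -/
theorem card_parallelLines_sdiff_le (hL : IsPartialAffine n L) (hn : 2 ≤ n) {k : ℕ}
    {f g : Finset W} (hf : f ∈ L) (hg : g ∈ L)
    (hfk : ∑ Q ∈ f, defect n L Q = k) (hgk : ∑ Q ∈ g, defect n L Q = k)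
    (hfd : ∀ Q ∈ f, defect n L Q ≤ 1) (hgd : ∀ Q ∈ g, defect n L Q ≤ 1) (hgf : Disjoint g f) :
    (parallelLines L f \ parallelLines L g).card ≤ k * (k - 1) := by
  have hsub : parallelLines L f \ parallelLines L g ⊆
      (g.filter (fun Q => defect n L Q ≠ 0)).biUnion
        (fun x => (disjointLinesThrough L x f).erase g) := by
    intro z hz
    rw [Finset.mem_sdiff] at hz
    obtain ⟨hzL, hzf, hzg, x, hxz, hxg, hx⟩ :=
      hL.exists_mem_of_notMem_parallelLines hn hf hg hgf hz.1 hz.2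
    rw [Finset.mem_biUnion]
    exact ⟨x, Finset.mem_filter.2 ⟨hxg, hx⟩, Finset.mem_erase.2 ⟨hzg,
      mem_disjointLinesThrough.2 ⟨hzL, hxz, hzf⟩⟩⟩
  refine (Finset.card_le_card hsub).trans ?_
  have h1 := Finset.card_biUnion_le_card_mul (g.filter (fun Q => defect n L Q ≠ 0))
    (fun x => (disjointLinesThrough L x f).erase g) (k - 1) ?_
  · rwa [card_filter_defect_ne_zero hgd, hgk] at h1
  · intro x hx
    rw [Finset.mem_filter] at hx
    have hxf : x ∉ f := fun h => Finset.disjoint_left.1 hgf hx.1 h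
    have h2 := hL.card_disjointLinesThrough hn hf hxf
    have h3 := hL.card_unjoined_inter_le hn x hfd
    have h4 := hgd x hx.1
    rw [Finset.card_erase_of_mem (mem_disjointLinesThrough.2 ⟨hg, hx.1, hgf⟩)]
    omega

/-- A family of lines closed under parallels, each with the same small number of points of defect
one and no points of larger defect, is partitioned into parallel classes. -/
theorem parallelLines_subset (hL : IsPartialAffine n L) (hn : 2 ≤ n) {e k : ℕ}
    (he : L.card + e = n ^ 2 + n) (hk : k ^ 2 < n) {F : Finset (Finset W)} (hFL : F ⊆ L)
    (hF : ∀ f ∈ F, ∀ m ∈ L, Disjoint m f → m ∈ F)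
    (hFk : ∀ f ∈ F, ∑ Q ∈ f, defect n L Q = k) (hFd : ∀ f ∈ F, ∀ Q ∈ f, defect n L Q ≤ 1)
    {f g : Finset W} (hf : f ∈ F) (hg : g ∈ L) (hgf : Disjoint g f) :
    parallelLines L g ⊆ parallelLines L f := by
  intro y hy
  by_contra hyf
  have hgF := hF f hf g hg hgf
  have hyF : y ∈ F := by
    rcases mem_parallelLines.1 hy with rfl | h
    · exact hgF
    · exact hF g hgF y h.1 h.2
  -- If `y` were not parallel to `f`, at least `n - k` parallels of `f` would not be parallel to
  -- `g`, while there are at most `k * (k - 1)` of these; thus `n ≤ k ^ 2`.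
  have h1 := hL.card_parallelLines_inter_add_le hn he (hFL hf) hg (hFL hyF) (hFk f hf) (hFk y hyF)
    (hFd y hyF) hy hyf
  have h2 := hL.card_parallelLines_sdiff_le hn (hFL hf) hg (hFk f hf) (hFk g hgF) (hFd f hf)
    (hFd g hgF) hgf
  have h3 := Finset.card_sdiff_add_card_inter (parallelLines L f) (parallelLines L g)
  have h4 := hL.card_parallelLines hn he (hFL hf)
  rw [hFk f hf] at h4
  have h5 : k * (k - 1) + k = k ^ 2 := by
    cases k with
    | zero => rfl
    | succ k => simp only [Nat.add_sub_cancel]; ring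
  omega

theorem eq_of_disjoint_of_mem (hL : IsPartialAffine n L) (hn : 2 ≤ n) {e k : ℕ}
    (he : L.card + e = n ^ 2 + n) (hk : k ^ 2 < n) {F : Finset (Finset W)} (hFL : F ⊆ L)
    (hF : ∀ f ∈ F, ∀ m ∈ L, Disjoint m f → m ∈ F)
    (hFk : ∀ f ∈ F, ∑ Q ∈ f, defect n L Q = k) (hFd : ∀ f ∈ F, ∀ Q ∈ f, defect n L Q ≤ 1)
    {f m m' : Finset W} (hf : f ∈ F) (hm : m ∈ L) (hm' : m' ∈ L) {Q : W} (hQm : Q ∈ m)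
    (hQm' : Q ∈ m') (hd : Disjoint m f) (hd' : Disjoint m' f) : m = m' := by
  have h1 := hL.parallelLines_subset hn he hk hFL hF hFk hFd (hF f hf m hm hd) (hFL hf) hd.symm
    (mem_parallelLines.2 (Or.inr ⟨hm', hd'⟩))
  rcases mem_parallelLines.1 h1 with h1 | h1
  · exact h1.symm
  · exact (Finset.disjoint_left.1 h1.2 hQm' hQm).elim

end IsPartialAffine

end ParallelFamilies

/-! ### A point whose defect is the number of missing lines -/

section ConcurrentMissing

variable {W : Type*} [Fintype W] [DecidableEq W] {n : ℕ} {L : Finset (Finset W)}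

namespace IsPartialAffine

/-- If `e` lines are missing and some point `Z` has defect `e`, then the points not joined to `Z` have
defect one and the remaining points different from `Z` have defect zero. -/
theorem defect_eq_ite_of_defect_eq (hL : IsPartialAffine n L) (hn : 2 ≤ n) {e : ℕ}
    (he : L.card + e = n ^ 2 + n) {Z : W} (hZ : defect n L Z = e) {Q : W} (hQ : Q ≠ Z) :
    defect n L Q = if Q ∈ unjoined L Z then 1 else 0 := by
  -- Unjoined points have defect at least one. The defect remaining outside `Z` is `n * e - e`,
  -- which is exactly the number of points unjoined to `Z`, so equality holds at every point.
  have h1 : ∑ Q ∈ Finset.univ.erase Z, defect n L Q =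
      ∑ Q ∈ Finset.univ.erase Z, if Q ∈ unjoined L Z then 1 else 0 := by
    have h2 := Finset.add_sum_erase Finset.univ (defect n L) (Finset.mem_univ Z)
    rw [hL.sum_defect hn he, hZ] at h2
    rw [← Finset.card_filter]
    have h3 : (Finset.univ.erase Z).filter (fun Q => Q ∈ unjoined L Z) = unjoined L Z := by
      ext R
      simp only [Finset.mem_filter, Finset.mem_erase, Finset.mem_univ, and_true,
        and_iff_right_iff_imp]
      exact fun h => (mem_unjoined.1 h).1
    rw [h3, hL.card_unjoined hn, hZ]
    obtain ⟨m, rfl⟩ : ∃ m, n = m + 1 := ⟨n - 1, by omega⟩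
    rw [Nat.add_sub_cancel]
    linarith
  refine ((Finset.sum_eq_sum_iff_of_le ?_).1 h1.symm Q (by simp [hQ])).symm
  intro R _
  split_ifs with h
  · exact hL.defect_pos_of_mem_unjoined hn h
  · exact Nat.zero_le _

theorem exists_isCompletion_of_defect_eq (hL : IsPartialAffine n L) (hn : 2 ≤ n) {e : ℕ}
    (he : L.card + e = n ^ 2 + n) (hen : (e - 1) ^ 2 < n) {Z : W} (hZ : defect n L Z = e) :
    ∃ M, IsCompletion n L M := by
  have hdef : ∀ Q, Q ≠ Z → defect n L Q = if Q ∈ unjoined L Z then 1 else 0 := fun Q hQ =>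
    hL.defect_eq_ite_of_defect_eq hn he hZ hQ
  have hle : ∀ Q, Q ≠ Z → defect n L Q ≤ 1 := by
    intro Q hQ
    rw [hdef Q hQ]
    split_ifs <;> simp
  refine hL.exists_isCompletion_of_defect_le_one hn ?_ ?_
  swap
  · intro Q R hQ hR
    have hQZ : Q = Z := by
      by_contra h
      have := hle Q h
      omega
    have hRZ : R = Z := by
      by_contra h
      have := hle R h
      omega
    rw [hQZ, hRZ]
  have hzero : ∀ h ∈ L, Z ∈ h → ∀ Y ∈ h, Y ≠ Z → defect n L Y = 0 := by
    intro h hh hZh Y hY hYZ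
    rw [hdef Y hYZ, if_neg]
    exact fun hc => (mem_unjoined.1 hc).2 h hh ⟨hZh, hY⟩
  -- a line disjoint from a line through `Z` is parallel to no line meeting the latter
  have hkey : ∀ h ∈ L, Z ∈ h → ∀ f ∈ L, Z ∉ f → ∀ m ∈ L, Disjoint m f → Disjoint m h →
      Disjoint f h := by
    intro h hh hZh f hf hZf m hm hmf hmh
    by_contra hfh
    obtain ⟨Y, hYf, hYh⟩ := Finset.not_disjoint_iff.1 hfh
    have hYZ : Y ≠ Z := fun hc => hZf (hc ▸ hYf)
    have := hL.eq_of_disjoint_of_defect_eq_zero hn hm (hzero h hh hZh Y hYh hYZ) hf hh hYf hYh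
      hmf.symm hmh.symm
    exact hZf (this ▸ hZh)
  intro Q hQ l hl hQl
  by_cases hQZ : Q = Z
  -- Here `Z` itself has defect one, and all points of positive defect lie in its star of `n`
  -- points. A point `R` of the star has `n - 1` unjoined points, so it is unjoined to the whole
  -- rest of the star.
  · rw [hQZ] at hQ hQl ⊢
    rw [Finset.card_le_one]
    intro R hR S hS
    rw [Finset.mem_inter] at hR hS
    by_contra hRS
    have hRZ := (mem_unjoined.1 hR.1).1
    have hdR : defect n L R = 1 := by rw [hdef R hRZ, if_pos hR.1]
    have hsub : unjoined L R ⊆ (closedStar L Z).erase R := by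
      intro T hT
      rw [Finset.mem_erase, mem_closedStar]
      refine ⟨(mem_unjoined.1 hT).1, ?_⟩
      by_cases hTZ : T = Z
      · exact Or.inl hTZ
      · have h1 := hL.defect_pos_of_mem_unjoined hn hT
        rw [hdef T hTZ] at h1
        exact Or.inr (by by_contra hc; rw [if_neg hc] at h1; omega)
    have heq := Finset.eq_of_subset_of_card_le hsub (by
      rw [Finset.card_erase_of_mem (mem_closedStar.2 (Or.inr hR.1)), hL.card_closedStar hn hQ,
        hL.card_unjoined hn, hdR, mul_one])
    have hSR : S ∈ unjoined L R := by
      rw [heq, Finset.mem_erase, mem_closedStar]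
      exact ⟨Ne.symm hRS, Or.inr hS.1⟩
    exact (mem_unjoined.1 hSR).2 l hl ⟨hR.2, hS.2⟩
  have hQu : Q ∈ unjoined L Z := by
    by_contra hc
    rw [hdef Q hQZ, if_neg hc] at hQ
    omega
  by_cases hZl : Z ∈ l
  · rw [Finset.card_le_one]
    have : ∀ R ∈ unjoined L Q ∩ l, R = Z := by
      intro R hR
      by_contra hRZ
      rw [Finset.mem_inter] at hR
      have h1 := hL.defect_pos_of_mem_unjoined hn hR.1
      rw [hzero l hl hZl R hR.2 hRZ] at h1
      omega
    intro R hR S hS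
    rw [this R hR, this S hS]
  -- These lines carry exactly `e - 1` points of positive defect, since no line through `Z` is
  -- disjoint from them, and `hkey` makes the family closed under parallels.
  set F := L.filter (fun f => Z ∉ f ∧ ∀ h ∈ L, Z ∈ h → ¬ Disjoint f h) with hFdef
  have hmF : ∀ f, f ∈ F ↔ f ∈ L ∧ Z ∉ f ∧ ∀ h ∈ L, Z ∈ h → ¬ Disjoint f h := by
    intro f
    rw [hFdef, Finset.mem_filter]
  refine hL.card_unjoined_inter_le_one hn hl hQl hQ fun m hm m' hm' hQm hQm' hd hd' => ?_
  have hZm : ∀ m ∈ L, Q ∈ m → Z ∉ m := fun m hm hQm hZm =>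
    (mem_unjoined.1 hQu).2 m hm ⟨hZm, hQm⟩
  by_cases hlF : l ∈ F
  · refine hL.eq_of_disjoint_of_mem hn he hen (Finset.filter_subset _ _) ?_ ?_ ?_ hlF hm hm' hQm
      hQm' hd hd'
    · intro f hf m hm hmf
      rw [hmF] at hf ⊢
      refine ⟨hm, fun hZm => hf.2.2 m hm hZm hmf.symm, fun h hh hZh hmh => ?_⟩
      exact hf.2.2 h hh hZh (hkey h hh hZh f hf.1 hf.2.1 m hm hmf hmh)
    · intro f hf
      rw [hmF] at hf
      have h1 := hL.card_disjointLinesThrough hn hf.1 hf.2.1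
      have h2 : disjointLinesThrough L Z f = ∅ := by
        rw [Finset.eq_empty_iff_forall_notMem]
        intro h hh
        rw [mem_disjointLinesThrough] at hh
        exact hf.2.2 h hh.1 hh.2.1 hh.2.2.symm
      rw [h2, Finset.card_empty, zero_add, hZ] at h1
      have h3 : ∑ Q ∈ f, defect n L Q = (unjoined L Z ∩ f).card := by
        rw [Finset.inter_comm, ← Finset.filter_mem_eq_inter, Finset.card_filter]
        exact Finset.sum_congr rfl fun R hR => hdef R fun hc => hf.2.1 (hc ▸ hR)
      omega
    · intro f hf R hR
      rw [hmF] at hf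
      exact hle R fun hc => hf.2.1 (hc ▸ hR)
  -- Now `l` is disjoint from a line `h` through `Z`, so by `hkey` both candidates are disjoint from
  -- `h`. The only point of `h` unjoined to `Q` is `Z`, so only one line through `Q` avoids `h`.
  · rw [hmF] at hlF
    push Not at hlF
    obtain ⟨h, hh, hZh, hlh⟩ := hlF hl hZl
    have h1 := hkey h hh hZh m hm (hZm m hm hQm) l hl hd.symm hlh
    have h2 := hkey h hh hZh m' hm' (hZm m' hm' hQm') l hl hd'.symm hlh
    have hQh : Q ∉ h := fun hc => hZm h hh hc hZh
    have h3 := hL.card_disjointLinesThrough hn hh hQh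
    have h4 : unjoined L Q ∩ h = {Z} := by
      ext R
      rw [Finset.mem_inter, Finset.mem_singleton]
      constructor
      · intro hR
        by_contra hRZ
        have h5 := hL.defect_pos_of_mem_unjoined hn hR.1
        rw [hzero h hh hZh R hR.2 hRZ] at h5
        omega
      · rintro rfl
        exact ⟨unjoined_symm hQu, hZh⟩
    rw [h4, hQ, Finset.card_singleton] at h3
    exact Finset.card_le_one.1 (by omega : (disjointLinesThrough L Q h).card ≤ 1) m
      (mem_disjointLinesThrough.2 ⟨hm, hQm, h1⟩) m' (mem_disjointLinesThrough.2 ⟨hm', hQm', h2⟩)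

end IsPartialAffine

end ConcurrentMissing

/-! ### A line all of whose points have defect zero -/

section FullLine

variable {W : Type*} [Fintype W] [DecidableEq W] {n : ℕ} {L : Finset (Finset W)}

namespace IsPartialAffine

/-- All defects are at most one if some line has only points of defect zero. -/
theorem defect_le_one_of_full_line (hL : IsPartialAffine n L) (hn : 2 ≤ n) {l₀ : Finset W}
    (hl₀ : l₀ ∈ L) (h₀ : ∀ Q ∈ l₀, defect n L Q = 0) (Q : W) : defect n L Q ≤ 1 := by
  by_cases hQ : Q ∈ l₀
  · rw [h₀ Q hQ]; exact Nat.zero_le _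
  · have h1 := hL.card_disjointLinesThrough hn hl₀ hQ
    have h2 := hL.card_unjoined_inter_le hn (l := l₀) Q (fun R hR => (h₀ R hR).le.trans zero_le_one)
    rw [Finset.sum_eq_zero h₀] at h2
    omega

theorem defect_eq_zero_of_disjoint_full_line (hL : IsPartialAffine n L) (hn : 2 ≤ n)
    {l₀ : Finset W} (hl₀ : l₀ ∈ L) (h₀ : ∀ Q ∈ l₀, defect n L Q = 0) {m : Finset W} (hm : m ∈ L)
    (hd : Disjoint m l₀) {Q : W} (hQ : Q ∈ m) : defect n L Q = 0 := by
  have hQl : Q ∉ l₀ := Finset.disjoint_left.1 hd hQ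
  have h1 := hL.card_disjointLinesThrough hn hl₀ hQl
  have h2 := hL.card_unjoined_inter_le hn (l := l₀) Q (fun R hR => (h₀ R hR).le.trans zero_le_one)
  rw [Finset.sum_eq_zero h₀] at h2
  have h3 : 0 < (disjointLinesThrough L Q l₀).card :=
    Finset.card_pos.2 ⟨m, mem_disjointLinesThrough.2 ⟨hm, hQ, hd⟩⟩
  omega

/-- A line meeting a full line meets all lines disjoint from the latter. -/
theorem not_disjoint_of_meets_full_line (hL : IsPartialAffine n L) (hn : 2 ≤ n) {l₀ : Finset W}
    (hl₀ : l₀ ∈ L) (h₀ : ∀ Q ∈ l₀, defect n L Q = 0) {f m : Finset W} (hf : f ∈ L)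
    (hne : f ≠ l₀) (hfl : ¬ Disjoint f l₀) (hm : m ∈ L) (hd : Disjoint m l₀) : ¬ Disjoint m f := by
  intro hmf
  obtain ⟨Y, hYf, hYl⟩ := Finset.not_disjoint_iff.1 hfl
  exact hne (hL.eq_of_disjoint_of_defect_eq_zero hn hm (h₀ Y hYl) hf hl₀ hYf hYl hmf.symm hd.symm)

/-- The line `f` meets each of the `n - e` parallels of `l₀` in one point. A point lies on exactly
one of these parallels if its defect is zero, and on none otherwise. -/
theorem sum_defect_of_meets_full_line (hL : IsPartialAffine n L) (hn : 2 ≤ n) {e : ℕ}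
    (he : L.card + e = n ^ 2 + n) {l₀ : Finset W} (hl₀ : l₀ ∈ L)
    (h₀ : ∀ Q ∈ l₀, defect n L Q = 0) {f : Finset W} (hf : f ∈ L) (hne : f ≠ l₀)
    (hfl : ¬ Disjoint f l₀) : ∑ Q ∈ f, defect n L Q = e := by
  have hKL : ∀ m ∈ parallelLines L l₀, m ∈ L := by
    intro m hm
    rcases mem_parallelLines.1 hm with rfl | h
    · exact hl₀
    · exact h.1
  have h1 := sum_card_filter_mem f (parallelLines L l₀)
  have h2 : ∑ m ∈ parallelLines L l₀, (f.filter (fun Q => Q ∈ m)).card =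
      (parallelLines L l₀).card := by
    rw [Finset.card_eq_sum_ones]
    refine Finset.sum_congr rfl fun m hm => ?_
    have hnd : ¬ Disjoint m f := by
      rcases mem_parallelLines.1 hm with rfl | h
      · exact fun hc => hfl hc.symm
      · exact hL.not_disjoint_of_meets_full_line hn hl₀ h₀ hf hne hfl h.1 h.2
    have hmf : m ≠ f := by
      rintro rfl
      rcases mem_parallelLines.1 hm with h | h
      · exact hne h
      · exact hfl h.2
    obtain ⟨Y, hYm, hYf⟩ := Finset.not_disjoint_iff.1 hnd
    rw [Finset.card_eq_one]
    refine ⟨Y, ?_⟩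
    ext R
    simp only [Finset.mem_filter, Finset.mem_singleton]
    refine ⟨fun hR => hL.eq_of_inter (hKL m hm) hf hmf hR.2 hR.1 hYm hYf, ?_⟩
    rintro rfl
    exact ⟨hYf, hYm⟩
  have h3 : ∑ Q ∈ f, (((parallelLines L l₀).filter (fun m => Q ∈ m)).card + defect n L Q) = n := by
    rw [Finset.sum_const_nat (m := 1), hL.card_line f hf, mul_one]
    intro Q _
    by_cases hQ : Q ∈ l₀
    · rw [h₀ Q hQ, add_zero, Finset.card_eq_one]
      refine ⟨l₀, ?_⟩
      ext m
      simp only [Finset.mem_filter, Finset.mem_singleton, mem_parallelLines]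
      constructor
      · rintro ⟨h | h, hQm⟩
        · exact h
        · exact (Finset.disjoint_left.1 h.2 hQm hQ).elim
      · rintro rfl
        exact ⟨Or.inl rfl, hQ⟩
    · have h4 := hL.card_disjointLinesThrough hn hl₀ hQ
      have h5 := hL.card_unjoined_inter_le hn (l := l₀) Q
        (fun R hR => (h₀ R hR).le.trans zero_le_one)
      rw [Finset.sum_eq_zero h₀] at h5
      have h6 : (parallelLines L l₀).filter (fun m => Q ∈ m) = disjointLinesThrough L Q l₀ := by
        ext m
        rw [Finset.mem_filter, mem_parallelLines, mem_disjointLinesThrough]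
        constructor
        · rintro ⟨rfl | h, hQm⟩
          · exact (hQ hQm).elim
          · exact ⟨h.1, hQm, h.2⟩
        · rintro ⟨hm, hQm, hd⟩
          exact ⟨Or.inr ⟨hm, hd⟩, hQm⟩
      rw [h6]
      omega
  have h7 := hL.card_parallelLines hn he hl₀
  rw [Finset.sum_eq_zero h₀] at h7
  rw [Finset.sum_add_distrib] at h3
  omega

/-- The lines meeting a full line are closed under parallels. -/
theorem meets_full_line_of_disjoint (hL : IsPartialAffine n L) (hn : 2 ≤ n) {l₀ : Finset W}
    (hl₀ : l₀ ∈ L) (h₀ : ∀ Q ∈ l₀, defect n L Q = 0) {f m : Finset W} (hf : f ∈ L)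
    (hne : f ≠ l₀) (hfl : ¬ Disjoint f l₀) (hm : m ∈ L) (hd : Disjoint m f) :
    m ≠ l₀ ∧ ¬ Disjoint m l₀ := by
  constructor
  · rintro rfl
    exact hfl hd.symm
  · exact fun h => hL.not_disjoint_of_meets_full_line hn hl₀ h₀ hf hne hfl hm h hd

/-- Lines equal to or disjoint from `l₀` contain only points of defect zero, so unique parallels
need to be checked only for lines meeting `l₀`. -/
theorem exists_isCompletion_of_full_line_of_meets (hL : IsPartialAffine n L) (hn : 2 ≤ n)
    {l₀ : Finset W} (hl₀ : l₀ ∈ L) (h₀ : ∀ Q ∈ l₀, defect n L Q = 0)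
    (h : ∀ Q, defect n L Q = 1 → ∀ f ∈ L, f ≠ l₀ → ¬ Disjoint f l₀ → Q ∉ f →
      (unjoined L Q ∩ f).card ≤ 1) : ∃ M, IsCompletion n L M := by
  have hle := hL.defect_le_one_of_full_line hn hl₀ h₀
  refine hL.exists_isCompletion_of_defect_le_one hn ?_ ?_
  · intro Q hQ l hl hQl
    by_cases hmeet : l ≠ l₀ ∧ ¬ Disjoint l l₀
    · exact h Q hQ l hl hmeet.1 hmeet.2 hQl
    · have hz : ∀ R ∈ l, defect n L R = 0 := by
        intro R hR
        by_cases hll : l = l₀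
        · exact h₀ R (hll ▸ hR)
        · exact hL.defect_eq_zero_of_disjoint_full_line hn hl₀ h₀ hl
            (not_not.1 fun hc => hmeet ⟨hll, hc⟩) hR
      have h1 := hL.card_unjoined_inter_le hn (l := l) Q (fun R _ => hle R)
      rw [Finset.sum_eq_zero hz] at h1
      omega
  · intro Q R hQ
    have := hle Q
    omega

theorem exists_isCompletion_of_full_line (hL : IsPartialAffine n L) (hn : 2 ≤ n) {e : ℕ}
    (he : L.card + e = n ^ 2 + n) (hen : e ^ 2 < n) {l₀ : Finset W} (hl₀ : l₀ ∈ L)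
    (h₀ : ∀ Q ∈ l₀, defect n L Q = 0) : ∃ M, IsCompletion n L M := by
  refine hL.exists_isCompletion_of_full_line_of_meets hn hl₀ h₀ ?_
  intro Q hQ f hf hne hfl hQf
  refine hL.card_unjoined_inter_le_one hn hf hQf hQ fun m hm m' hm' hQm hQm' hd hd' => ?_
  refine hL.eq_of_disjoint_of_mem (F := L.filter (fun f => f ≠ l₀ ∧ ¬ Disjoint f l₀)) hn he hen
    (Finset.filter_subset _ _) ?_ ?_ ?_ (Finset.mem_filter.2 ⟨hf, hne, hfl⟩) hm hm' hQm hQm' hd hd'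
  · intro f hf m hm hmf
    rw [Finset.mem_filter] at hf ⊢
    exact ⟨hm, hL.meets_full_line_of_disjoint hn hl₀ h₀ hf.1 hf.2.1 hf.2.2 hm hmf⟩
  · intro f hf
    rw [Finset.mem_filter] at hf
    exact hL.sum_defect_of_meets_full_line hn he hl₀ h₀ hf.1 hf.2.1 hf.2.2
  · exact fun f _ R _ => hL.defect_le_one_of_full_line hn hl₀ h₀ R

/-- A point of defect `d` and its `(n - 1) * d` unjoined points contribute at least `n * d` to the
total defect `n * e`. -/
theorem defect_le (hL : IsPartialAffine n L) (hn : 2 ≤ n) {e : ℕ}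
    (he : L.card + e = n ^ 2 + n) (Q : W) : defect n L Q ≤ e := by
  have h1 : ∑ R ∈ closedStar L Q, defect n L R ≤ ∑ R, defect n L R :=
    Finset.sum_le_sum_of_subset (Finset.subset_univ _)
  rw [hL.sum_defect hn he, closedStar, Finset.sum_insert self_notMem_unjoined] at h1
  have h2 : (unjoined L Q).card * 1 ≤ ∑ R ∈ unjoined L Q, defect n L R := by
    rw [← smul_eq_mul]
    exact Finset.card_nsmul_le_sum _ _ _ fun R hR => hL.defect_pos_of_mem_unjoined hn hR
  rw [hL.card_unjoined hn, mul_one] at h2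
  have h3 : (n - 1) * defect n L Q + defect n L Q = n * defect n L Q := by
    obtain ⟨m, rfl⟩ : ∃ m, n = m + 1 := ⟨n - 1, by omega⟩
    rw [Nat.add_sub_cancel]
    ring
  exact Nat.le_of_mul_le_mul_left (by omega : n * defect n L Q ≤ n * e) (by omega)

theorem exists_isCompletion_of_one_missing (hL : IsPartialAffine n L) (hn : 2 ≤ n)
    (he : L.card + 1 = n ^ 2 + n) : ∃ M, IsCompletion n L M := by
  have h1 := hL.sum_defect hn he
  obtain ⟨Z, -, hZ⟩ : ∃ Z ∈ Finset.univ, defect n L Z ≠ 0 :=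
    Finset.exists_ne_zero_of_sum_ne_zero (by rw [h1]; omega)
  have h2 := hL.defect_le hn he Z
  exact hL.exists_isCompletion_of_defect_eq hn he (by simp; omega) (by omega : defect n L Z = 1)

end IsPartialAffine

end FullLine

/-! ### Two missing lines in order four, with a full line -/

section TwoMissing

variable {W : Type*} [Fintype W] [DecidableEq W] {n : ℕ} {L : Finset (Finset W)}

namespace IsPartialAffine

/-- In order four, with two missing lines and a full line: two joined points that are both not joined
to a third point have the same unjoined points, which are pairwise joined. -/
theorem unjoined_eq_of_common (hL : IsPartialAffine 4 L) (he : L.card + 2 = 4 ^ 2 + 4)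
    {l₀ : Finset W} (hl₀ : l₀ ∈ L) (h₀ : ∀ Q ∈ l₀, defect 4 L Q = 0) {a b x : W} (hab : a ≠ b)
    (hb : b ∉ unjoined L a) (hxa : x ∈ unjoined L a) (hxb : x ∈ unjoined L b) :
    unjoined L a = unjoined L b ∧ ∀ y ∈ unjoined L a, ∀ y' ∈ unjoined L a, y' ∉ unjoined L y := by
  have hn : 2 ≤ 4 := by norm_num
  have hle := hL.defect_le_one_of_full_line hn hl₀ h₀
  have hda : 0 < defect 4 L a := hL.defect_pos_of_mem_unjoined hn (unjoined_symm hxa)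
  have hdb : 0 < defect 4 L b := hL.defect_pos_of_mem_unjoined hn (unjoined_symm hxb)
  obtain ⟨f, hf, haf, hbf⟩ := exists_line_of_notMem_unjoined hab.symm hb
  have hfF : f ≠ l₀ ∧ ¬ Disjoint f l₀ := by
    constructor
    · rintro rfl
      rw [h₀ a haf] at hda
      omega
    · intro hd
      rw [hL.defect_eq_zero_of_disjoint_full_line hn hl₀ h₀ hf hd haf] at hda
      omega
  have hsum : ∀ g ∈ L, Disjoint g f → ∑ Q ∈ g, defect 4 L Q = 2 := by
    intro g hg hgf
    have h1 := hL.meets_full_line_of_disjoint hn hl₀ h₀ hf hfF.1 hfF.2 hg hgf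
    exact hL.sum_defect_of_meets_full_line hn he hl₀ h₀ hg h1.1 h1.2
  have hfsum := hL.sum_defect_of_meets_full_line hn he hl₀ h₀ hf hfF.1 hfF.2
  have hK := hL.card_parallelLines hn he hf
  rw [hfsum] at hK
  -- a point lies on at most two lines disjoint from `f`, with equality only for common points
  have hthrough : ∀ y, y ∉ f → ∀ g ∈ disjointLinesThrough L y f, ∀ h ∈ disjointLinesThrough L y f,
      g ≠ h → (disjointLinesThrough L y f).card = 2 ∧ y ∈ unjoined L a ∧ y ∈ unjoined L b := by
    intro y hyf g hg h hh hgh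
    have h1 := hL.card_disjointLinesThrough hn hf hyf
    have h2 := hL.card_unjoined_inter_le hn (l := f) y (fun R _ => hle R)
    have h3 : 1 < (disjointLinesThrough L y f).card := Finset.one_lt_card.2 ⟨g, hg, h, hh, hgh⟩
    have hdy := hle y
    have h4 : defect 4 L y = 1 := by
      by_contra hc
      have h5 := hL.card_unjoined hn y
      rw [(by omega : defect 4 L y = 0), mul_zero, Finset.card_eq_zero] at h5
      rw [h5] at h1
      simp at h1
      omega
    have hsub : unjoined L y ∩ f ⊆ f.filter (fun Q => defect 4 L Q ≠ 0) := by
      intro R hR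
      rw [Finset.mem_inter] at hR
      exact Finset.mem_filter.2 ⟨hR.2, (hL.defect_pos_of_mem_unjoined hn hR.1).ne'⟩
    have h6 := card_filter_defect_ne_zero (n := 4) (L := L) (s := f) (fun R _ => hle R)
    have heq := Finset.eq_of_subset_of_card_le hsub (by omega)
    have hay : a ∈ unjoined L y ∩ f := by
      rw [heq, Finset.mem_filter]
      exact ⟨haf, by omega⟩
    have hby : b ∈ unjoined L y ∩ f := by
      rw [heq, Finset.mem_filter]
      exact ⟨hbf, by omega⟩
    exact ⟨by omega, unjoined_symm (Finset.mem_inter.1 hay).1,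
      unjoined_symm (Finset.mem_inter.1 hby).1⟩
  have hxf : x ∉ f := fun hc => (mem_unjoined.1 hxa).2 f hf ⟨haf, hc⟩
  obtain ⟨g, hg, h, hh, hgh⟩ : ∃ g ∈ disjointLinesThrough L x f,
      ∃ h ∈ disjointLinesThrough L x f, g ≠ h := by
    rw [← Finset.one_lt_card]
    have h1 := hL.card_disjointLinesThrough hn hf hxf
    have h2 : 1 < (unjoined L x ∩ f).card := Finset.one_lt_card.2
      ⟨a, Finset.mem_inter.2 ⟨unjoined_symm hxa, haf⟩, b,
        Finset.mem_inter.2 ⟨unjoined_symm hxb, hbf⟩, hab⟩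
    have := hle x
    omega
  have hx2 := hthrough x hxf g hg h hh hgh
  have hx3 : disjointLinesThrough L x f = {g, h} := by
    symm
    refine Finset.eq_of_subset_of_card_le ?_ ?_
    · intro t ht
      rw [Finset.mem_insert, Finset.mem_singleton] at ht
      rcases ht with rfl | rfl <;> assumption
    · rw [hx2.1, Finset.card_pair hgh]
  rw [mem_disjointLinesThrough] at hg hh
  have hne : ∀ m, Disjoint m f → m ≠ f := by
    rintro m hm rfl
    rw [disjoint_self.1 hm] at haf
    simp at haf
  -- The line `f` has four parallels including itself, and `g`, `h` are those through `x`. The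
  -- fourth one, `z`, will meet `g` and `h` in points `y`, `y'` lying on two parallels of `f`; so
  -- `x`, `y`, `y'` are the three points unjoined to `a`, and likewise to `b`.
  obtain ⟨z, hzK, hz⟩ : ∃ z ∈ parallelLines L f, z ∉ ({f, g, h} : Finset (Finset W)) := by
    apply Finset.exists_mem_notMem_of_card_lt_card
    have := Finset.card_le_three (a := f) (b := g) (c := h)
    omega
  simp only [Finset.mem_insert, Finset.mem_singleton, not_or] at hz
  obtain ⟨hzf, hzg, hzh⟩ := hz
  have hz := (mem_parallelLines.1 hzK).resolve_left hzf
  have hxz : x ∉ z := by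
    intro hxz
    have h1 : z ∈ disjointLinesThrough L x f := mem_disjointLinesThrough.2 ⟨hz.1, hxz, hz.2⟩
    rw [hx3, Finset.mem_insert, Finset.mem_singleton] at h1
    exact h1.elim hzg hzh
  -- `z` meets each of two intersecting parallels of `f`
  have hmeet : ∀ g' ∈ L, ∀ h' ∈ L, Disjoint g' f → Disjoint h' f → x ∈ g' → x ∈ h' → g' ≠ h' →
      z ≠ g' → ∃ y ∈ z, y ∈ g' := by
    intro g' hg' h' hh' hgf hhf hxg hxh hgh' hzg'
    -- Here `k ^ 2 = n`, so `parallelLines_subset` does not apply. But `f`, `g'` and `z` would be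
    -- three common parallels of `f` and `g'`, where a failure of transitivity allows two. So `f`
    -- and `g'` would have the same parallels, although `h'` meets `g'`.
    have h1 : z ∉ parallelLines L g' := by
      intro hzK'
      have hsub : ¬ ∃ y ∈ parallelLines L g', y ∉ parallelLines L f := by
        rintro ⟨y, hy, hyf⟩
        have hyL : y ∈ L := by
          rcases mem_parallelLines.1 hy with rfl | h
          · exact hg'
          · exact h.1
        have hg'F := hL.meets_full_line_of_disjoint hn hl₀ h₀ hf hfF.1 hfF.2 hg' hgf
        have hysum : ∑ Q ∈ y, defect 4 L Q = 2 := by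
          rcases mem_parallelLines.1 hy with rfl | h
          · exact hsum _ hg' hgf
          · have h2 := hL.meets_full_line_of_disjoint hn hl₀ h₀ hg' hg'F.1 hg'F.2 h.1 h.2
            exact hL.sum_defect_of_meets_full_line hn he hl₀ h₀ h.1 h2.1 h2.2
        have h2 := hL.card_parallelLines_inter_add_le hn he hf hg' hyL hfsum hysum
          (fun Q _ => hle Q) hy hyf
        have h3 : 2 < (parallelLines L f ∩ parallelLines L g').card := by
          rw [Finset.two_lt_card]
          refine ⟨f, ?_, g', ?_, z, ?_, (hne g' hgf).symm, Ne.symm hzf, Ne.symm hzg'⟩ <;>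
            rw [Finset.mem_inter]
          · exact ⟨mem_parallelLines.2 (Or.inl rfl), mem_parallelLines.2 (Or.inr ⟨hf, hgf.symm⟩)⟩
          · exact ⟨mem_parallelLines.2 (Or.inr ⟨hg', hgf⟩), mem_parallelLines.2 (Or.inl rfl)⟩
          · exact ⟨hzK, hzK'⟩
        omega
      push Not at hsub
      have h4 := hL.card_parallelLines hn he hg'
      rw [hsum g' hg' hgf] at h4
      have heq := Finset.eq_of_subset_of_card_le (fun y hy => hsub y hy) (by omega)
      have h5 : h' ∈ parallelLines L g' := by
        rw [heq]
        exact mem_parallelLines.2 (Or.inr ⟨hh', hhf⟩)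
      rcases mem_parallelLines.1 h5 with h5 | h5
      · exact hgh' h5.symm
      · exact Finset.disjoint_left.1 h5.2 hxh hxg
    obtain ⟨-, -, -, y, hyz, hyg, -⟩ := hL.exists_mem_of_notMem_parallelLines hn hf hg' hgf hzK h1
    exact ⟨y, hyz, hyg⟩
  obtain ⟨y, hyz, hyg⟩ := hmeet g hg.1 h hh.1 hg.2.2 hh.2.2 hg.2.1 hh.2.1 hgh hzg
  obtain ⟨y', hyz', hyh'⟩ := hmeet h hh.1 g hg.1 hh.2.2 hg.2.2 hh.2.1 hg.2.1 hgh.symm hzh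
  have hyx : y ≠ x := fun hc => hxz (hc ▸ hyz)
  have hyx' : y' ≠ x := fun hc => hxz (hc ▸ hyz')
  have hyy' : y ≠ y' := fun hc =>
    hyx (hL.eq_of_inter hg.1 hh.1 hgh hyg (hc ▸ hyh') hg.2.1 hh.2.1)
  have hyab := hthrough y (Finset.disjoint_left.1 hz.2 hyz) z
    (mem_disjointLinesThrough.2 ⟨hz.1, hyz, hz.2⟩) g
    (mem_disjointLinesThrough.2 ⟨hg.1, hyg, hg.2.2⟩) hzg
  have hyab' := hthrough y' (Finset.disjoint_left.1 hz.2 hyz') z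
    (mem_disjointLinesThrough.2 ⟨hz.1, hyz', hz.2⟩) h
    (mem_disjointLinesThrough.2 ⟨hh.1, hyh', hh.2.2⟩) hzh
  have hset : ∀ c, defect 4 L c ≤ 1 → x ∈ unjoined L c → y ∈ unjoined L c → y' ∈ unjoined L c →
      unjoined L c = {x, y, y'} := by
    intro c hc h1 h2 h3
    symm
    refine Finset.eq_of_subset_of_card_le ?_ ?_
    · intro t ht
      simp only [Finset.mem_insert, Finset.mem_singleton] at ht
      rcases ht with rfl | rfl | rfl <;> assumption
    · have h4 : ({x, y, y'} : Finset W).card = 3 := by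
        rw [Finset.card_eq_three]
        exact ⟨x, y, y', hyx.symm, hyx'.symm, hyy', rfl⟩
      rw [h4, hL.card_unjoined hn]
      omega
  have ha := hset a (hle a) hxa hyab.2.1 hyab'.2.1
  have hb := hset b (hle b) hxb hyab.2.2 hyab'.2.2
  refine ⟨ha.trans hb.symm, ?_⟩
  have hj : ∀ m ∈ L, ∀ s t, s ∈ m → t ∈ m → t ∉ unjoined L s := fun m hm s t hs ht hc =>
    (mem_unjoined.1 hc).2 m hm ⟨hs, ht⟩
  rw [ha]
  intro s hs t ht
  simp only [Finset.mem_insert, Finset.mem_singleton] at hs ht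
  rcases hs with rfl | rfl | rfl <;> rcases ht with rfl | rfl | rfl
  · exact self_notMem_unjoined
  · exact hj g hg.1 _ _ hg.2.1 hyg
  · exact hj h hh.1 _ _ hh.2.1 hyh'
  · exact hj g hg.1 _ _ hyg hg.2.1
  · exact self_notMem_unjoined
  · exact hj z hz.1 _ _ hyz hyz'
  · exact hj h hh.1 _ _ hyh' hh.2.1
  · exact hj z hz.1 _ _ hyz' hyz
  · exact self_notMem_unjoined

/-- The total defect is eight, so eight points have defect one, each unjoined to three others. If
unique parallels failed, `unjoined_eq_of_common` would force a component `K_{3,3}` in the graph of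
unjoined pairs, and the two points left over could not have three unjoined points each. -/
theorem exists_isCompletion_of_full_line_four (hL : IsPartialAffine 4 L)
    (he : L.card + 2 = 4 ^ 2 + 4) {l₀ : Finset W} (hl₀ : l₀ ∈ L)
    (h₀ : ∀ Q ∈ l₀, defect 4 L Q = 0) : ∃ M, IsCompletion 4 L M := by
  have hn : 2 ≤ 4 := by norm_num
  have hle := hL.defect_le_one_of_full_line hn hl₀ h₀
  refine hL.exists_isCompletion_of_full_line_of_meets hn hl₀ h₀ ?_
  intro x hx f hf _ _ hxf
  rw [Finset.card_le_one]
  intro a ha b hb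
  rw [Finset.mem_inter] at ha hb
  by_contra hab
  have hthree : ∀ p q, q ∈ unjoined L p → (unjoined L p).card = 3 := by
    intro p q hq
    have h1 := hL.defect_pos_of_mem_unjoined hn (unjoined_symm hq)
    have h2 := hle p
    rw [hL.card_unjoined hn, (by omega : defect 4 L p = 1)]
  have hxa := unjoined_symm ha.1
  have hxb := unjoined_symm hb.1
  have hnab : b ∉ unjoined L a := fun hc => (mem_unjoined.1 hc).2 f hf ⟨ha.2, hb.2⟩
  obtain ⟨hNab, hind⟩ := hL.unjoined_eq_of_common he hl₀ h₀ hab hnab hxa hxb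
  obtain ⟨c, hc, hcab⟩ : ∃ c ∈ unjoined L x, c ∉ ({a, b} : Finset W) := by
    apply Finset.exists_mem_notMem_of_card_lt_card
    rw [hthree x a ha.1]
    exact lt_of_le_of_lt Finset.card_le_two (by norm_num)
  simp only [Finset.mem_insert, Finset.mem_singleton, not_or] at hcab
  have hac : c ∉ unjoined L a := fun h => hind x hxa c h hc
  have hNac := (hL.unjoined_eq_of_common he hl₀ h₀ (Ne.symm hcab.1) hac hxa (unjoined_symm hc)).1
  have habc : ({a, b, c} : Finset W).card = 3 := by
    rw [Finset.card_eq_three]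
    exact ⟨a, b, c, hab, Ne.symm hcab.1, Ne.symm hcab.2, rfl⟩
  have hNy : ∀ y ∈ unjoined L a, unjoined L y = {a, b, c} := by
    intro y hy
    symm
    refine Finset.eq_of_subset_of_card_le ?_ ?_
    · intro t ht
      simp only [Finset.mem_insert, Finset.mem_singleton] at ht
      rcases ht with rfl | rfl | rfl
      · exact unjoined_symm hy
      · exact unjoined_symm (hNab ▸ hy)
      · exact unjoined_symm (hNac ▸ hy)
    · rw [habc, hthree y a (unjoined_symm hy)]
  set S := unjoined L a ∪ {a, b, c} with hS
  have hclosed : ∀ s ∈ S, unjoined L s ⊆ S := by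
    intro s hs
    rw [hS, Finset.mem_union] at hs
    rcases hs with hs | hs
    · rw [hNy s hs]
      exact Finset.subset_union_right
    · simp only [Finset.mem_insert, Finset.mem_singleton] at hs
      rcases hs with rfl | rfl | rfl
      · exact Finset.subset_union_left
      · rw [← hNab]
        exact Finset.subset_union_left
      · rw [← hNac]
        exact Finset.subset_union_left
  have hScard : S.card = 6 := by
    rw [hS, Finset.card_union_of_disjoint, habc, hthree a x hxa]
    rw [Finset.disjoint_left]
    intro y hy hy'
    simp only [Finset.mem_insert, Finset.mem_singleton] at hy'
    rcases hy' with rfl | rfl | rfl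
    · exact self_notMem_unjoined hy
    · exact hnab hy
    · exact hac hy
  set X := Finset.univ.filter (fun Q => defect 4 L Q ≠ 0) with hX
  have hXcard : X.card = 8 := by
    rw [hX, card_filter_defect_ne_zero (fun Q _ => hle Q), hL.sum_defect hn he]
  have hSX : S ⊆ X := by
    intro s hs
    rw [hX, Finset.mem_filter]
    refine ⟨Finset.mem_univ _, ?_⟩
    have : ∃ t, s ∈ unjoined L t := by
      rw [hS, Finset.mem_union] at hs
      rcases hs with hs | hs
      · exact ⟨a, hs⟩
      · exact ⟨x, by rwa [hNy x hxa]⟩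
    obtain ⟨t, ht⟩ := this
    exact (hL.defect_pos_of_mem_unjoined hn ht).ne'
  obtain ⟨q, hqX, hqS⟩ : ∃ q ∈ X, q ∉ S :=
    Finset.exists_mem_notMem_of_card_lt_card (by omega)
  have hNq : unjoined L q ⊆ (X \ S).erase q := by
    intro t ht
    rw [Finset.mem_erase, Finset.mem_sdiff, hX, Finset.mem_filter]
    exact ⟨(mem_unjoined.1 ht).1, ⟨Finset.mem_univ _, (hL.defect_pos_of_mem_unjoined hn ht).ne'⟩,
      fun hc => hqS (hclosed t hc (unjoined_symm ht))⟩
  have h1 := Finset.card_le_card hNq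
  rw [Finset.card_erase_of_mem (Finset.mem_sdiff.2 ⟨hqX, hqS⟩), Finset.card_sdiff_of_subset hSX,
    hXcard, hScard, hL.card_unjoined hn] at h1
  have h2 := hle q
  have h3 := (Finset.mem_filter.1 hqX).2
  omega

end IsPartialAffine

end TwoMissing

/-! ### Two missing lines: existence of a full line -/

section FullLineExists

variable {W : Type*} [Fintype W] [DecidableEq W] {n : ℕ} {L : Finset (Finset W)}

namespace IsPartialAffine

/-- If two lines are missing and all defects are at most one, then some line has at most one point of
positive defect. -/
theorem exists_line_sum_defect_le_one (hL : IsPartialAffine n L) (hn : 3 ≤ n)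
    (he : L.card + 2 = n ^ 2 + n) (hle : ∀ Q, defect n L Q ≤ 1) :
    ∃ l ∈ L, ∑ Q ∈ l, defect n L Q ≤ 1 := by
  have hn2 : 2 ≤ n := by omega
  by_contra hc
  push Not at hc
  -- There are `2 * n` points of positive defect, each on `n` lines. Two of them on every line would
  -- require `2 * (n ^ 2 + n - 2) ≤ 2 * n ^ 2`, which fails for `n ≥ 3`.
  have h1 : L.card • 2 ≤ ∑ l ∈ L, ∑ Q ∈ l, defect n L Q := Finset.card_nsmul_le_sum _ _ _ hc
  have h2 := sum_valency_mul Finset.univ L (defect n L)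
  simp only [Finset.filter_univ_mem] at h2
  have h3 : ∑ Q, (L.filter (fun m => Q ∈ m)).card * defect n L Q = n * ∑ Q, defect n L Q := by
    rw [Finset.mul_sum]
    refine Finset.sum_congr rfl fun Q _ => ?_
    have h4 := hL.valency_add_defect hn2 Q
    unfold valency blocksThrough at h4
    have h5 := hle Q
    interval_cases hd : defect n L Q
    · simp
    · simp only [mul_one]
      omega
  rw [← h2, h3, hL.sum_defect hn2 he, smul_eq_mul] at h1
  nlinarith

/-- Without a full line, some `l` has a single point `x` of positive defect. Its `n - 1` parallels
share out the `n` points of the star of `x`, at least one each, so exactly one parallel `l'` gets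
two. A further line `m₀` disjoint from `l'` then consists of points of positive defect, and at most
three such points can lie on it. -/
theorem exists_full_line_of_two_missing (hL : IsPartialAffine n L) (hn : 4 ≤ n)
    (he : L.card + 2 = n ^ 2 + n) (hle : ∀ Q, defect n L Q ≤ 1) :
    ∃ l₀ ∈ L, ∀ Q ∈ l₀, defect n L Q = 0 := by
  have hn2 : 2 ≤ n := by omega
  by_contra hfull
  have hpos : ∀ m ∈ L, 1 ≤ ∑ Q ∈ m, defect n L Q := by
    intro m hm
    by_contra hc
    refine hfull ⟨m, hm, fun Q hQ => ?_⟩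
    exact (Finset.sum_eq_zero_iff.1 (by omega : ∑ Q ∈ m, defect n L Q = 0)) Q hQ
  have hfilter : ∀ m : Finset W, (m.filter (fun Q => defect n L Q ≠ 0)).card =
      ∑ Q ∈ m, defect n L Q := fun m => card_filter_defect_ne_zero fun Q _ => hle Q
  obtain ⟨l, hl, hl1⟩ := hL.exists_line_sum_defect_le_one (by omega) he hle
  have hlsum : ∑ Q ∈ l, defect n L Q = 1 := le_antisymm hl1 (hpos l hl)
  obtain ⟨x, hx⟩ := Finset.card_eq_one.1 ((hfilter l).trans hlsum)
  have hxl : x ∈ l ∧ defect n L x ≠ 0 := by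
    have : x ∈ l.filter (fun Q => defect n L Q ≠ 0) := by rw [hx]; simp
    exact Finset.mem_filter.1 this
  have hxu : ∀ y ∈ l, defect n L y ≠ 0 → y = x := by
    intro y hy hd
    have : y ∈ l.filter (fun Q => defect n L Q ≠ 0) := Finset.mem_filter.2 ⟨hy, hd⟩
    rwa [hx, Finset.mem_singleton] at this
  have hdx : defect n L x = 1 := by
    have := hle x
    omega
  -- the parallels of `l` are pairwise disjoint
  set K := parallelLines L l with hK
  have hKL : ∀ m ∈ K, m ∈ L := by
    intro m hm
    rcases mem_parallelLines.1 hm with rfl | h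
    · exact hl
    · exact h.1
  have hKcard : K.card + 2 = n + 1 := by rw [hK, hL.card_parallelLines hn2 he hl, hlsum]
  have hKeq : ∀ m ∈ K, ∀ m' ∈ K, ∀ Y, Y ∈ m → Y ∈ m' → m = m' := by
    intro m hm m' hm' Y hYm hYm'
    rcases mem_parallelLines.1 hm with rfl | h <;> rcases mem_parallelLines.1 hm' with rfl | h'
    · rfl
    · exact (Finset.disjoint_left.1 h'.2 hYm' hYm).elim
    · exact (Finset.disjoint_left.1 h.2 hYm hYm').elim
    · have hYl : Y ∉ l := Finset.disjoint_left.1 h.2 hYm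
      have h1 := hL.card_disjointLinesThrough hn2 hl hYl
      have h2 := hL.card_unjoined_inter_le hn2 (l := l) Y (fun R _ => hle R)
      have h3 : (disjointLinesThrough L Y l).card ≤ 1 := by
        by_cases hdY : defect n L Y = 0
        · exact (hL.card_disjointLinesThrough_of_defect_eq_zero hn2 hl hYl hdY).le
        · omega
      exact Finset.card_le_one.1 h3 m (mem_disjointLinesThrough.2 ⟨h.1, hYm, h.2⟩) m'
        (mem_disjointLinesThrough.2 ⟨h'.1, hYm', h'.2⟩)
  have hKdisj : ∀ m ∈ K, ∀ m' ∈ K, m ≠ m' → Disjoint m m' := by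
    intro m hm m' hm' hne
    rw [Finset.disjoint_left]
    exact fun Y hY hY' => hne (hKeq m hm m' hm' Y hY hY')
  have hKzero : ∀ Y, defect n L Y = 0 → ∃ m ∈ K, Y ∈ m := by
    intro Y hY
    by_cases hYl : Y ∈ l
    · exact ⟨l, mem_parallelLines.2 (Or.inl rfl), hYl⟩
    · obtain ⟨m, hm, hYm, hd⟩ := hL.exists_disjoint_of_defect_eq_zero hn2 hl hYl hY
      exact ⟨m, mem_parallelLines.2 (Or.inr ⟨hm, hd⟩), hYm⟩
  -- they contain exactly the points of the star of `x` among the points of positive defect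
  set A := closedStar L x with hA
  have hAcard : A.card = n := hL.card_closedStar hn2 hdx
  have hApos : ∀ a ∈ A, defect n L a ≠ 0 := by
    intro a ha
    rcases mem_closedStar.1 ha with rfl | ha
    · exact hxl.2
    · exact (hL.defect_pos_of_mem_unjoined hn2 ha).ne'
  have hAK : ∀ a ∈ A, ∃ m ∈ K, a ∈ m := by
    intro a ha
    have hda := hle a
    rcases mem_closedStar.1 ha with rfl | ha
    · exact ⟨l, mem_parallelLines.2 (Or.inl rfl), hxl.1⟩
    · have hal : a ∉ l := fun hc => (mem_unjoined.1 ha).2 l hl ⟨hxl.1, hc⟩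
      have h1 := hL.card_disjointLinesThrough hn2 hl hal
      have h2 : 0 < (unjoined L a ∩ l).card :=
        Finset.card_pos.2 ⟨x, Finset.mem_inter.2 ⟨unjoined_symm ha, hxl.1⟩⟩
      obtain ⟨m, hm⟩ := Finset.card_pos.1 (by omega : 0 < (disjointLinesThrough L a l).card)
      rw [mem_disjointLinesThrough] at hm
      exact ⟨m, mem_parallelLines.2 (Or.inr ⟨hm.1, hm.2.2⟩), hm.2.1⟩
  have hmeets : ∀ q m m', m ∈ L → m' ∈ L → q ∈ m → Disjoint m m' → defect n L q ≠ 0 →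
      ∃ r ∈ m', defect n L r ≠ 0 ∧ r ∈ unjoined L q := by
    intro q m m' hm hm' hq hd hdq
    have h1 := hL.card_disjointLinesThrough hn2 hm' (Finset.disjoint_left.1 hd hq)
    have h2 : 0 < (disjointLinesThrough L q m').card :=
      Finset.card_pos.2 ⟨m, mem_disjointLinesThrough.2 ⟨hm, hq, hd⟩⟩
    obtain ⟨r, hr⟩ := Finset.card_pos.1 (by omega : 0 < (unjoined L q ∩ m').card)
    rw [Finset.mem_inter] at hr
    exact ⟨r, hr.2, (hL.defect_pos_of_mem_unjoined hn2 hr.1).ne', hr.1⟩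
  have hKA : ∀ m ∈ K, ∀ q ∈ m, defect n L q ≠ 0 → q ∈ A := by
    intro m hm q hq hdq
    rcases mem_parallelLines.1 hm with rfl | h
    · rw [hxu q hq hdq]
      exact self_mem_closedStar x
    · obtain ⟨r, hrl, hdr, hr⟩ := hmeets q m l h.1 hl hq h.2 hdq
      rw [hxu r hrl hdr] at hr
      exact mem_closedStar.2 (Or.inr (unjoined_symm hr))
  have hsum : ∑ m ∈ K, ∑ Q ∈ m, defect n L Q = n := by
    have h1 := sum_card_filter_mem A K
    have h2 : ∑ Q ∈ A, (K.filter (fun m => Q ∈ m)).card = n := by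
      rw [Finset.sum_const_nat (m := 1), hAcard, mul_one]
      intro a ha
      obtain ⟨m, hm, ham⟩ := hAK a ha
      rw [Finset.card_eq_one]
      refine ⟨m, ?_⟩
      ext m'
      rw [Finset.mem_filter, Finset.mem_singleton]
      constructor
      · exact fun h => hKeq m' h.1 m hm a h.2 ham
      · rintro rfl
        exact ⟨hm, ham⟩
    refine Eq.trans ?_ (h1.symm.trans h2)
    refine Finset.sum_congr rfl fun m hm => ?_
    rw [← hfilter m]
    congr 1
    ext q
    simp only [Finset.mem_filter]
    exact ⟨fun h => ⟨hKA m hm q h.1 h.2, h.1⟩, fun h => ⟨h.2, hApos q h.1⟩⟩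
  obtain ⟨l', hl'K, hl'2⟩ : ∃ l' ∈ K, 1 < ∑ Q ∈ l', defect n L Q := by
    by_contra hc
    push Not at hc
    have := Finset.sum_le_card_nsmul K _ 1 hc
    rw [hsum, smul_eq_mul] at this
    omega
  have hl'L := hKL l' hl'K
  have hrest := Finset.add_sum_erase K (fun m => ∑ Q ∈ m, defect n L Q) hl'K
  rw [hsum] at hrest
  have hErase : (K.erase l').card = n - 2 := by
    rw [Finset.card_erase_of_mem hl'K]
    omega
  have hlow : ∑ m ∈ K.erase l', 1 ≤ ∑ m ∈ K.erase l', ∑ Q ∈ m, defect n L Q :=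
    Finset.sum_le_sum fun m hm => hpos m (hKL m (Finset.mem_of_mem_erase hm))
  have hlow' : ∑ m ∈ K.erase l', 1 = n - 2 := by rw [← Finset.card_eq_sum_ones, hErase]
  have hl'sum : ∑ Q ∈ l', defect n L Q = 2 := by
    omega
  have hone : ∀ m ∈ K, m ≠ l' → ∑ Q ∈ m, defect n L Q = 1 := by
    intro m hm hne
    refine ((Finset.sum_eq_sum_iff_of_le
      (fun m hm => hpos m (hKL m (Finset.mem_of_mem_erase hm)))).1 ?_ m
      (Finset.mem_erase.2 ⟨hne, hm⟩)).symm
    omega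
  -- the line `l'` has a further parallel
  obtain ⟨m₀, hm₀, hm₀K⟩ : ∃ m ∈ disjointLines L l', m ∉ K.erase l' := by
    apply Finset.exists_mem_notMem_of_card_lt_card
    have := hL.card_disjointLines hn2 he hl'L
    omega
  rw [mem_disjointLines] at hm₀
  -- Through a point of defect zero the only line disjoint from `l'` belongs to `K`, which `m₀` does
  -- not.
  have hm₀zero : ∀ Y ∈ m₀, defect n L Y ≠ 0 := by
    intro Y hY hdY
    obtain ⟨z, hzK, hYz⟩ := hKzero Y hdY
    have hzl' : z ≠ l' := by
      rintro rfl
      exact Finset.disjoint_left.1 hm₀.2 hY hYz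
    have := hL.eq_of_disjoint_of_defect_eq_zero hn2 hl'L hdY (hKL z hzK) hm₀.1 hYz hY
      (hKdisj z hzK l' hl'K hzl') hm₀.2
    exact hm₀K (Finset.mem_erase.2 ⟨this ▸ hzl', this ▸ hzK⟩)
  -- The line of `K` through `y` has no other point of positive defect, so a point of `A` on another
  -- line of `K`, which lies on a line disjoint from it, must be unjoined to `y`.
  have hclique : ∀ y ∈ A, y ∉ l' → ∀ a ∈ A, a ≠ y → a ∈ unjoined L y := by
    intro y hy hyl' a ha hay
    obtain ⟨m, hmK, hym⟩ := hAK y hy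
    have hml' : m ≠ l' := by
      rintro rfl
      exact hyl' hym
    have h1 := (hfilter m).trans (hone m hmK hml')
    have huniq : ∀ r ∈ m, defect n L r ≠ 0 → r = y := by
      intro r hr hdr
      exact Finset.card_le_one.1 h1.le r (Finset.mem_filter.2 ⟨hr, hdr⟩) y
        (Finset.mem_filter.2 ⟨hym, hApos y hy⟩)
    obtain ⟨m', hm'K, ham'⟩ := hAK a ha
    have hmm' : m' ≠ m := by
      rintro rfl
      exact hay (huniq a ham' (hApos a ha))
    obtain ⟨r, hrm, hdr, hr⟩ := hmeets a m' m (hKL m' hm'K) (hKL m hmK) ham'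
      (hKdisj m' hm'K m hmK hmm') (hApos a ha)
    rw [huniq r hrm hdr] at hr
    exact unjoined_symm hr
  obtain ⟨u, v, huv, hset⟩ := Finset.card_eq_two.1 ((hfilter l').trans hl'sum)
  have hmem : ∀ r, r ∈ l' → defect n L r ≠ 0 → r = u ∨ r = v := by
    intro r hr hdr
    have : r ∈ l'.filter (fun Q => defect n L Q ≠ 0) := Finset.mem_filter.2 ⟨hr, hdr⟩
    rwa [hset, Finset.mem_insert, Finset.mem_singleton] at this
  have huA : u ∈ A ∧ v ∈ A := by
    have hu : u ∈ l'.filter (fun Q => defect n L Q ≠ 0) := by rw [hset]; simp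
    have hv : v ∈ l'.filter (fun Q => defect n L Q ≠ 0) := by rw [hset]; simp
    rw [Finset.mem_filter] at hu hv
    exact ⟨hKA l' hl'K u hu.1 hu.2, hKA l' hl'K v hv.1 hv.2⟩
  have hout : ∀ w ∈ A, w = u ∨ w = v → (unjoined L w \ A).card ≤ 1 := by
    intro w hw hwuv
    have hsub : A \ {u, v} ⊆ unjoined L w ∩ A := by
      intro y hy
      simp only [Finset.mem_sdiff, Finset.mem_insert, Finset.mem_singleton, not_or] at hy
      rw [Finset.mem_inter]
      refine ⟨unjoined_symm (hclique y hy.1 (fun hc => ?_) w hw ?_), hy.1⟩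
      · rcases hmem y hc (hApos y hy.1) with h | h
        · exact hy.2.1 h
        · exact hy.2.2 h
      · rintro rfl
        rcases hwuv with h | h
        · exact hy.2.1 h
        · exact hy.2.2 h
    have h1 := Finset.card_le_card hsub
    have h2 : ({u, v} : Finset W) ⊆ A := by
      intro t ht
      rw [Finset.mem_insert, Finset.mem_singleton] at ht
      rcases ht with rfl | rfl
      · exact huA.1
      · exact huA.2
    rw [Finset.card_sdiff_of_subset h2, hAcard, Finset.card_pair huv] at h1
    have h3 := Finset.card_sdiff_add_card_inter (unjoined L w) A
    have h4 := hle w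
    have h5 := hApos w hw
    rw [hL.card_unjoined hn2, (by omega : defect n L w = 1)] at h3
    omega
  -- Points of `m₀` outside `A` are unjoined to `u` or `v`, each of which has at most one unjoined
  -- point outside `A`. At most one point of `m₀` is in `A`, whence `n ≤ 3`.
  have hcover : m₀ ⊆ (m₀ ∩ A) ∪ ((unjoined L u \ A) ∪ (unjoined L v \ A)) := by
    intro w hw
    rw [Finset.mem_union, Finset.mem_union, Finset.mem_inter, Finset.mem_sdiff, Finset.mem_sdiff]
    by_cases hwA : w ∈ A
    · exact Or.inl ⟨hw, hwA⟩
    · obtain ⟨r, hrl', hdr, hr⟩ := hmeets w m₀ l' hm₀.1 hl'L hw hm₀.2 (hm₀zero w hw)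
      rcases hmem r hrl' hdr with rfl | rfl
      · exact Or.inr (Or.inl ⟨unjoined_symm hr, hwA⟩)
      · exact Or.inr (Or.inr ⟨unjoined_symm hr, hwA⟩)
  have hone' : (m₀ ∩ A).card ≤ 1 := by
    rw [Finset.card_le_one]
    intro y hy y' hy'
    rw [Finset.mem_inter] at hy hy'
    by_contra hne
    have h1 := hclique y hy.2 (Finset.disjoint_left.1 hm₀.2 hy.1) y' hy'.2 (Ne.symm hne)
    exact (mem_unjoined.1 h1).2 m₀ hm₀.1 ⟨hy.1, hy'.1⟩
  have h1 := Finset.card_le_card hcover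
  have h2 := Finset.card_union_le (m₀ ∩ A) ((unjoined L u \ A) ∪ (unjoined L v \ A))
  have h3 := Finset.card_union_le (unjoined L u \ A) (unjoined L v \ A)
  have h4 := hout u huA.1 (Or.inl rfl)
  have h5 := hout v huA.2 (Or.inr rfl)
  rw [hL.card_line m₀ hm₀.1] at h1
  omega

theorem exists_isCompletion_of_two_missing (hL : IsPartialAffine n L) (hn : 4 ≤ n)
    (he : L.card + 2 = n ^ 2 + n) : ∃ M, IsCompletion n L M := by
  have hn2 : 2 ≤ n := by omega
  by_cases hle : ∀ Q, defect n L Q ≤ 1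
  · obtain ⟨l₀, hl₀, h₀⟩ := hL.exists_full_line_of_two_missing hn he hle
    rcases hn.eq_or_lt with rfl | hn5
    · exact hL.exists_isCompletion_of_full_line_four he hl₀ h₀
    · exact hL.exists_isCompletion_of_full_line hn2 he (by omega) hl₀ h₀
  · push Not at hle
    obtain ⟨Z, hZ⟩ := hle
    have := hL.defect_le hn2 he Z
    exact hL.exists_isCompletion_of_defect_eq hn2 he (by omega) (by omega : defect n L Z = 2)

end IsPartialAffine

end FullLineExists

/-! ### New circles at each point -/

section DerivedCompletion

variable {V : Type*}

/-- For each point `P`, a family `M P` of `(n + 1)`-sets through `P` which completes the derived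
structure at `P` of a set `C` of circles to an affine plane. -/
structure IsDerivedCompletion (n : ℕ) (C : Finset (Finset V)) (M : V → Finset (Finset V)) :
    Prop where
  mem : ∀ P, ∀ b ∈ M P, P ∈ b
  card : ∀ P, ∀ b ∈ M P, b.card = n + 1
  notMem : ∀ P, ∀ b ∈ M P, b ∉ C
  existsUnique : ∀ P Q R, P ≠ Q → P ≠ R → Q ≠ R →
    ∃! b, (b ∈ C ∨ b ∈ M P) ∧ P ∈ b ∧ Q ∈ b ∧ R ∈ b

variable {n : ℕ} {C : Finset (Finset V)} {M : V → Finset (Finset V)}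

namespace IsDerivedCompletion

theorem eq_of_mem (hM : IsDerivedCompletion n C M) {P Q R : V} (hPQ : P ≠ Q) (hPR : P ≠ R)
    (hQR : Q ≠ R) {b b' : Finset V} (hb : b ∈ M P) (hb' : b' ∈ M P) (hQ : Q ∈ b) (hR : R ∈ b)
    (hQ' : Q ∈ b') (hR' : R ∈ b') : b = b' :=
  (hM.existsUnique P Q R hPQ hPR hQR).unique ⟨Or.inr hb, hM.mem P b hb, hQ, hR⟩
    ⟨Or.inr hb', hM.mem P b' hb', hQ', hR'⟩

theorem exists_mem_iff (hM : IsDerivedCompletion n C M) {P Q R : V} (hPQ : P ≠ Q) (hPR : P ≠ R)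
    (hQR : Q ≠ R) :
    (∃ b ∈ M P, Q ∈ b ∧ R ∈ b) ↔ ∀ c ∈ C, ¬ (P ∈ c ∧ Q ∈ c ∧ R ∈ c) := by
  constructor
  · rintro ⟨b, hb, hQ, hR⟩ c hc h
    have := (hM.existsUnique P Q R hPQ hPR hQR).unique ⟨Or.inr hb, hM.mem P b hb, hQ, hR⟩
      ⟨Or.inl hc, h⟩
    exact hM.notMem P b hb (this ▸ hc)
  · intro h
    obtain ⟨b, ⟨hb, hP, hQ, hR⟩, -⟩ := hM.existsUnique P Q R hPQ hPR hQR
    rcases hb with hb | hb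
    · exact (h b hb ⟨hP, hQ, hR⟩).elim
    · exact ⟨b, hb, hQ, hR⟩

/-- New circles at `P` through `Q` and `R` correspond to new circles at `R` through `P` and `Q`. -/
theorem exists_mem_of_mem (hM : IsDerivedCompletion n C M) {P Q R : V} (hPQ : P ≠ Q) (hPR : P ≠ R)
    (hQR : Q ≠ R) {b : Finset V} (hb : b ∈ M P) (hQ : Q ∈ b) (hR : R ∈ b) :
    ∃ b' ∈ M R, P ∈ b' ∧ Q ∈ b' := by
  rw [hM.exists_mem_iff hPR.symm hQR.symm hPQ]
  exact fun c hc h => (hM.exists_mem_iff hPQ hPR hQR).1 ⟨b, hb, hQ, hR⟩ c hc ⟨h.2.1, h.2.2, h.1⟩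

theorem eq_of_subset (hM : IsDerivedCompletion n C M) {P R : V} {b b' : Finset V} (hb : b ∈ M P)
    (hb' : b' ∈ M R) (h : b ⊆ b') : b = b' :=
  Finset.eq_of_subset_of_card_le h (by rw [hM.card P b hb, hM.card R b' hb'])

end IsDerivedCompletion

end DerivedCompletion

/-! ### The completions at different points agree -/

section Gluing

variable {V : Type*} [DecidableEq V] {n : ℕ} {C : Finset (Finset V)}
  {M : V → Finset (Finset V)}

namespace IsDerivedCompletion

/-- If `Q` is on at most one new circle at `R` and is joined at `R` to all other points of `b` by new
circles, then `b` is a new circle at `R`. -/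
theorem mem_of_valency_le_one (hM : IsDerivedCompletion n C M) (hn : 2 ≤ n) {P Q R : V}
    {b : Finset V} (hb : b ∈ M P) (hv : valency (M R) Q ≤ 1)
    (h : ∀ S ∈ b, S ≠ Q → S ≠ R → ∃ b' ∈ M R, Q ∈ b' ∧ S ∈ b') : b ∈ M R := by
  obtain ⟨S₀, hS₀, hS₀'⟩ : ∃ S ∈ b, S ∉ ({Q, R} : Finset V) := by
    apply Finset.exists_mem_notMem_of_card_lt_card
    rw [hM.card P b hb]
    exact lt_of_le_of_lt Finset.card_le_two (by omega)
  simp only [Finset.mem_insert, Finset.mem_singleton, not_or] at hS₀'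
  obtain ⟨b₀, hb₀, hQ₀, -⟩ := h S₀ hS₀ hS₀'.1 hS₀'.2
  have hsub : b ⊆ b₀ := by
    intro S hS
    by_cases hSQ : S = Q
    · rwa [hSQ]
    by_cases hSR : S = R
    · rw [hSR]
      exact hM.mem R b₀ hb₀
    obtain ⟨b', hb', hQ', hS'⟩ := h S hS hSQ hSR
    have : b' = b₀ := Finset.card_le_one.1 hv b' (mem_blocksThrough.2 ⟨hb', hQ'⟩) b₀
      (mem_blocksThrough.2 ⟨hb₀, hQ₀⟩)
    rwa [← this]
  rwa [hM.eq_of_subset hb hb₀ hsub]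

/-- Each point counted lies on a new circle at `P` other than `b`. Such a circle shares at most one
point besides `P` with `b`, so different points use different circles. -/
theorem card_bad_lt (hM : IsDerivedCompletion n C M) {P : V} {b : Finset V} (hb : b ∈ M P) :
    ((b.erase P).filter (fun Q => 2 ≤ valency (M P) Q)).card + 1 ≤ (M P).card := by
  have hex : ∀ Q ∈ (b.erase P).filter (fun Q => 2 ≤ valency (M P) Q),
      ∃ b' ∈ (M P).erase b, Q ∈ b' := by
    intro Q hQ
    rw [Finset.mem_filter] at hQ
    obtain ⟨b', hb', hne⟩ := Finset.exists_mem_ne (by unfold valency at hQ; omega :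
      1 < (blocksThrough (M P) Q).card) b
    rw [mem_blocksThrough] at hb'
    exact ⟨b', Finset.mem_erase.2 ⟨hne, hb'.1⟩, hb'.2⟩
  choose! f hf hQf using hex
  have h1 : ((b.erase P).filter (fun Q => 2 ≤ valency (M P) Q)).card ≤ ((M P).erase b).card := by
    refine Finset.card_le_card_of_injOn f hf ?_
    intro Q hQ Q' hQ' h
    have h2 := Finset.mem_erase.1 (hf Q hQ)
    have h3 := Finset.mem_erase.1 (Finset.mem_filter.1 hQ).1
    have h4 := Finset.mem_erase.1 (Finset.mem_filter.1 hQ').1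
    by_contra hne
    exact h2.1 (hM.eq_of_mem h3.1.symm h4.1.symm hne h2.2 hb (hQf Q hQ) (h ▸ hQf Q' hQ') h3.2 h4.2)
  rw [Finset.card_erase_of_mem hb] at h1
  have : 0 < (M P).card := Finset.card_pos.2 ⟨b, hb⟩
  omega

/-- New circles joining, at `R`, a point `S` outside the new circle `b'` to points of `b'`. -/
theorem card_lt_of_joined (hM : IsDerivedCompletion n C M) {R S : V} {b' : Finset V}
    (hb' : b' ∈ M R) (hS : S ∉ b') {X : Finset V} (hX : X ⊆ b') (hRX : R ∉ X)
    (h : ∀ Q ∈ X, ∃ d ∈ M R, S ∈ d ∧ Q ∈ d) : X.card + 1 ≤ (M R).card := by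
  choose! f hf hSf hQf using h
  have hne : ∀ Q ∈ X, f Q ≠ b' := fun Q hQ hc => hS (hc ▸ hSf Q hQ)
  have h1 : X.card ≤ ((M R).erase b').card := by
    refine Finset.card_le_card_of_injOn f ?_ ?_
    · exact fun Q hQ => Finset.mem_erase.2 ⟨hne Q hQ, hf Q hQ⟩
    · intro Q hQ Q' hQ' h
      have hRQ : ∀ Q ∈ X, R ≠ Q := by
        rintro Q hQ rfl
        exact hRX hQ
      by_contra hQQ'
      exact hne Q hQ (hM.eq_of_mem (hRQ Q hQ) (hRQ Q' hQ') hQQ' (hf Q hQ) hb' (hQf Q hQ)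
        (h ▸ hQf Q' hQ') (hX hQ) (hX hQ'))
  rw [Finset.card_erase_of_mem hb'] at h1
  have : 0 < (M R).card := Finset.card_pos.2 ⟨b', hb'⟩
  omega

variable [Fintype V]

theorem card_filter_eq (hM : IsDerivedCompletion n C M) {P Q : V} (hPQ : P ≠ Q) :
    (Finset.univ.filter (fun R => R ≠ P ∧ R ≠ Q ∧ ∀ c ∈ C, ¬ (P ∈ c ∧ Q ∈ c ∧ R ∈ c))).card =
      valency (M P) Q * (n - 1) := by
  have h1 : Finset.univ.filter (fun R => R ≠ P ∧ R ≠ Q ∧ ∀ c ∈ C, ¬ (P ∈ c ∧ Q ∈ c ∧ R ∈ c)) =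
      (blocksThrough (M P) Q).biUnion (fun b => (b.erase P).erase Q) := by
    ext R
    simp only [Finset.mem_filter, Finset.mem_univ, true_and, Finset.mem_biUnion,
      mem_blocksThrough, Finset.mem_erase]
    constructor
    · rintro ⟨hRP, hRQ, h⟩
      obtain ⟨b, hb, hQ, hR⟩ := (hM.exists_mem_iff hPQ hRP.symm hRQ.symm).2 h
      exact ⟨b, ⟨hb, hQ⟩, hRQ, hRP, hR⟩
    · rintro ⟨b, ⟨hb, hQ⟩, hRQ, hRP, hR⟩
      exact ⟨hRP, hRQ, (hM.exists_mem_iff hPQ hRP.symm hRQ.symm).1 ⟨b, hb, hQ, hR⟩⟩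
  rw [h1, Finset.card_biUnion, valency, Finset.sum_const_nat]
  · intro b hb
    rw [mem_blocksThrough] at hb
    rw [Finset.card_erase_of_mem (Finset.mem_erase.2 ⟨hPQ.symm, hb.2⟩),
      Finset.card_erase_of_mem (hM.mem P b hb.1), hM.card P b hb.1]
    omega
  · intro b hb b' hb' hne
    rw [Finset.mem_coe, mem_blocksThrough] at hb hb'
    rw [Function.onFun, Finset.disjoint_left]
    intro R hR hR'
    simp only [Finset.mem_erase] at hR hR'
    exact hne (hM.eq_of_mem hPQ hR.2.1.symm hR.1.symm hb.1 hb'.1 hb.2 hR.2.2 hb'.2 hR'.2.2)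

/-- By `card_filter_eq` both sides, times `n - 1`, count the points lying on no circle of `C`
together with `P` and `Q`. -/
theorem valency_comm (hM : IsDerivedCompletion n C M) (hn : 2 ≤ n) {P Q : V} (hPQ : P ≠ Q) :
    valency (M P) Q = valency (M Q) P := by
  have h1 := hM.card_filter_eq hPQ
  have h2 := hM.card_filter_eq hPQ.symm
  have h3 : Finset.univ.filter (fun R => R ≠ P ∧ R ≠ Q ∧ ∀ c ∈ C, ¬ (P ∈ c ∧ Q ∈ c ∧ R ∈ c)) =
      Finset.univ.filter (fun R => R ≠ Q ∧ R ≠ P ∧ ∀ c ∈ C, ¬ (Q ∈ c ∧ P ∈ c ∧ R ∈ c)) := by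
    ext R
    simp only [Finset.mem_filter, Finset.mem_univ, true_and]
    constructor <;> exact fun h => ⟨h.2.1, h.1, fun c hc hh => h.2.2 c hc ⟨hh.2.1, hh.1, hh.2.2⟩⟩
  rw [h3, h2] at h1
  exact (Nat.eq_of_mul_eq_mul_right (by omega) h1).symm

/-- By `valency_comm` there is at most one new circle at `Q` through `P`, so it has to cover every
triple formed by `P`, `Q` and a third point of `b`. -/
theorem mem_of_valency_eq_one (hM : IsDerivedCompletion n C M) (hn : 2 ≤ n) {P Q : V}
    {b : Finset V} (hb : b ∈ M P) (hQ : Q ∈ b) (hPQ : P ≠ Q) (hv : valency (M P) Q ≤ 1) :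
    b ∈ M Q := by
  refine hM.mem_of_valency_le_one hn (Q := P) hb ?_ ?_
  · rwa [← hM.valency_comm hn hPQ]
  · intro S hS hSP hSQ
    exact hM.exists_mem_of_mem hSP.symm hPQ hSQ hb hS hQ

/-- A new circle at `P` is a new circle at each of its points. -/
theorem mem_of_mem (hM : IsDerivedCompletion n C M) (hn : 2 ≤ n)
    (hsmall : ∀ P, ((M P).card - 1) ^ 2 < n ∨ ∀ Q R, Q ≠ P → R ≠ P → 2 ≤ valency (M P) Q →
      2 ≤ valency (M P) R → Q = R) {P R : V} {b : Finset V} (hb : b ∈ M P) (hR : R ∈ b) :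
    b ∈ M R := by
  by_cases hPR : P = R
  · rwa [← hPR]
  by_contra hbR
  have hPb := hM.mem P b hb
  -- By `hjoin`, each point of `G` is joined by new circles at `R` to all other points of `b`. By
  -- `hGcard`, `G` contains almost all of `b`, since a point of `b` on only one new circle at `P`
  -- belongs to `G`.
  set G := b.filter (fun Q => Q ≠ R ∧ b ∈ M Q) with hG
  have hPG : P ∈ G := Finset.mem_filter.2 ⟨hPb, hPR, hb⟩
  have hjoin : ∀ Q ∈ G, ∀ S ∈ b, S ≠ Q → S ≠ R → ∃ b' ∈ M R, Q ∈ b' ∧ S ∈ b' := by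
    intro Q hQ S hS hSQ hSR
    rw [hG, Finset.mem_filter] at hQ
    exact hM.exists_mem_of_mem hSQ.symm hQ.2.1 hSR hQ.2.2 hS hR
  have hGcard : (G.card + (M P).card ≥ n + 2 ∧ ((M P).card - 1) ^ 2 < n) ∨ n ≤ G.card := by
    set B := (b.erase P).filter (fun Q => 2 ≤ valency (M P) Q) with hB
    have hcover : b ⊆ G ∪ B := by
      intro Q hQ
      rw [Finset.mem_union, hG, hB, Finset.mem_filter, Finset.mem_filter, Finset.mem_erase]
      by_cases hQP : Q = P
      · rw [hQP]
        exact Or.inl ⟨hPb, hPR, hb⟩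
      by_cases hv : 2 ≤ valency (M P) Q
      · exact Or.inr ⟨⟨hQP, hQ⟩, hv⟩
      · have hbQ := hM.mem_of_valency_eq_one hn hb hQ (Ne.symm hQP) (by omega)
        refine Or.inl ⟨hQ, ?_, hbQ⟩
        rintro rfl
        exact hbR hbQ
    have h1 := (Finset.card_le_card hcover).trans (Finset.card_union_le G B)
    rw [hM.card P b hb] at h1
    rcases hsmall P with h | h
    · have h2 := hM.card_bad_lt hb
      rw [← hB] at h2
      left
      exact ⟨by omega, h⟩
    · right
      have h2 : B.card ≤ 1 := by
        rw [Finset.card_le_one]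
        intro Q hQ Q' hQ'
        rw [hB, Finset.mem_filter, Finset.mem_erase] at hQ hQ'
        exact h Q Q' hQ.1.1 hQ'.1.1 hQ.2 hQ'.2
      omega
  rcases hsmall R with hsR | hsR
  · set e := (M R).card with he
    have hn1 : ∀ k : ℕ, (k - 1) ^ 2 < n → k ≤ n := by
      intro k hk
      by_contra hc
      have : n ≤ k - 1 := by omega
      nlinarith
    -- Otherwise `x = (M P).card - 1` and `y = e - 1` would satisfy `n + 1 ≤ x + y`, whereas `x ^ 2,
    -- y ^ 2 < n` gives `x + y ≤ n`.
    have hGe : ¬ G.card + 1 ≤ e := by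
      intro hc
      have h1 := hn1 e hsR
      rcases hGcard with h2 | h2
      · obtain ⟨x, hx⟩ : ∃ x, (M P).card = x + 1 := ⟨(M P).card - 1, by omega⟩
        obtain ⟨y, hy⟩ : ∃ y, e = y + 1 := ⟨e - 1, by omega⟩
        rw [hx] at h2
        rw [hy] at hsR hc
        simp only [Nat.add_sub_cancel] at h2 hsR
        have h3 : n + 1 ≤ x + y := by omega
        zify at h2 hsR h3
        nlinarith [sq_nonneg ((x : ℤ) - 1), sq_nonneg ((y : ℤ) - 1)]
      · omega
    -- A point of `b` outside `b'` that is joined at `R` to many points of `b'` uses as many new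
    -- circles besides `b'`. If `G ⊆ b'`, this would make `G` too small; otherwise a point of `G`
    -- outside `b'` bounds the intersection with `b`.
    have hle : ∀ b' ∈ blocksThrough (M R) P, (((b' ∩ b).erase R).erase P).card ≤ e - 2 := by
      intro b' hb'
      rw [mem_blocksThrough] at hb'
      by_cases hGb' : G ⊆ b'
      · exfalso
        obtain ⟨S, hS, hSb'⟩ : ∃ S ∈ b, S ∉ b' := by
          by_contra hc
          push Not at hc
          have := hM.eq_of_subset hb hb'.1 (fun S hS => hc S hS)
          exact hbR (this ▸ hb'.1)
        have hSR : S ≠ R := by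
          rintro rfl
          exact hSb' (hM.mem _ b' hb'.1)
        refine hGe (hM.card_lt_of_joined hb'.1 hSb' hGb' ?_ ?_)
        · intro hc
          exact (Finset.mem_filter.1 hc).2.1 rfl
        · intro Q hQ
          obtain ⟨d, hd, hQd, hSd⟩ := hjoin Q hQ S hS (fun hc => hSb' (hc ▸ hGb' hQ)) hSR
          exact ⟨d, hd, hSd, hQd⟩
      · obtain ⟨Z, hZG, hZb'⟩ := Finset.not_subset.1 hGb'
        have h1 : ((b' ∩ b).erase R).card + 1 ≤ e := by
          refine hM.card_lt_of_joined hb'.1 hZb' ?_ (Finset.notMem_erase _ _) ?_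
          · exact (Finset.erase_subset _ _).trans Finset.inter_subset_left
          · intro Q hQ
            rw [Finset.mem_erase, Finset.mem_inter] at hQ
            exact hjoin Z hZG Q hQ.2.2 (fun hc => hZb' (hc ▸ hQ.2.1)) hQ.1
        rw [Finset.card_erase_of_mem (Finset.mem_erase.2
          ⟨hPR, Finset.mem_inter.2 ⟨hb'.2, hPb⟩⟩)]
        omega
    have hcover : (b.erase R).erase P ⊆
        (blocksThrough (M R) P).biUnion (fun b' => ((b' ∩ b).erase R).erase P) := by
      intro S hS
      simp only [Finset.mem_erase] at hS
      obtain ⟨b', hb', hPb', hSb'⟩ := hjoin P hPG S hS.2.2 hS.1 hS.2.1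
      rw [Finset.mem_biUnion]
      refine ⟨b', mem_blocksThrough.2 ⟨hb', hPb'⟩, ?_⟩
      simp only [Finset.mem_erase, Finset.mem_inter]
      exact ⟨hS.1, hS.2.1, hSb', hS.2.2⟩
    -- The at most `e` new circles at `R` through `P` cover the other `n - 1` points of `b`, so `n -
    -- 1 ≤ e * (e - 2)`. For `e ≥ 2` this says `n ≤ (e - 1) ^ 2`, contrary to the assumption on `R`.
    have h1 := (Finset.card_le_card hcover).trans (Finset.card_biUnion_le_card_mul _ _ _ hle)
    rw [Finset.card_erase_of_mem (Finset.mem_erase.2 ⟨hPR, hPb⟩), Finset.card_erase_of_mem hR,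
      hM.card P b hb] at h1
    have h2 : (blocksThrough (M R) P).card ≤ e := Finset.card_le_card (Finset.filter_subset _ _)
    have h3 : (blocksThrough (M R) P).card * (e - 2) ≤ e * (e - 2) := Nat.mul_le_mul_right _ h2
    obtain ⟨y, hy⟩ | hy : (∃ y, e = y + 2) ∨ e ≤ 1 := by
      rcases le_or_gt e 1 with h | h
      · exact Or.inr h
      · exact Or.inl ⟨e - 2, by omega⟩
    · rw [hy] at h3 hsR
      have : y + 2 - 1 = y + 1 := rfl
      rw [this] at hsR
      rw [Nat.add_sub_cancel] at h3
      rw [hy, Nat.add_sub_cancel] at h1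
      have h4 : n + 1 - 1 - 1 ≤ (y + 2) * y := h1.trans h3
      have h5 : (y + 2) * y + 1 = (y + 1) ^ 2 := by ring
      omega
    · have : e - 2 = 0 := by omega
      rw [this, mul_zero] at h1
      omega
  -- Two points of `G` suffice: one of them lies on at most one new circle at `R`, and that circle
  -- must then be `b`.
  · have hG2 : 1 < G.card := by
      rcases hGcard with h | h
      · have : (M P).card ≤ n := by
          by_contra hc
          have : n ≤ (M P).card - 1 := by omega
          nlinarith
        omega
      · omega
    obtain ⟨Q, hQ, Q', hQ', hne⟩ := Finset.one_lt_card.1 hG2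
    have hcase : ∀ Q ∈ G, ¬ valency (M R) Q ≤ 1 := by
      intro Q hQ hv
      exact hbR (hM.mem_of_valency_le_one hn hb hv (hjoin Q hQ))
    exact hne (hsR Q Q' (Finset.mem_filter.1 hQ).2.1 (Finset.mem_filter.1 hQ').2.1
      (by have := hcase Q hQ; omega) (by have := hcase Q' hQ'; omega))

theorem exists_isInversivePlane (hM : IsDerivedCompletion n C M) (hn : 2 ≤ n)
    (hC : IsPartialInversivePlane n C)
    (hsmall : ∀ P, ((M P).card - 1) ^ 2 < n ∨ ∀ Q R, Q ≠ P → R ≠ P → 2 ≤ valency (M P) Q →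
      2 ≤ valency (M P) R → Q = R) :
    ∃ C' : Finset (Finset V), C ⊆ C' ∧ IsInversivePlane n C' := by
  refine ⟨C ∪ Finset.univ.biUnion M, Finset.subset_union_left, hC.1, ?_, ?_⟩
  · intro b hb
    rw [Finset.mem_union, Finset.mem_biUnion] at hb
    rcases hb with hb | ⟨P, -, hb⟩
    · exact hC.2.1 b hb
    · exact hM.card P b hb
  · intro T hT
    obtain ⟨P, Q, R, hPQ, hPR, hQR, rfl⟩ := Finset.card_eq_three.1 hT
    obtain ⟨b, ⟨hb, hP, hQ, hR⟩, huniq⟩ := hM.existsUnique P Q R hPQ hPR hQR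
    rw [Finset.card_eq_one]
    refine ⟨b, ?_⟩
    ext b'
    simp only [Finset.mem_filter, Finset.mem_union, Finset.mem_biUnion, Finset.mem_univ, true_and,
      Finset.mem_singleton, Finset.insert_subset_iff, Finset.singleton_subset_iff]
    constructor
    · rintro ⟨hb' | ⟨S, hb'⟩, hP', hQ', hR'⟩
      · exact huniq b' ⟨Or.inl hb', hP', hQ', hR'⟩
      · exact huniq b' ⟨Or.inr (hM.mem_of_mem hn hsmall hb' hP'), hP', hQ', hR'⟩
    · rintro rfl
      exact ⟨hb.imp_right fun h => ⟨P, h⟩, hP, hQ, hR⟩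

end IsDerivedCompletion

end Gluing

/-! ### From the criteria to the completed inversive plane -/

section Assembly

/-- One of the completion criteria implies that the missing lines complete the given partial affine
plane and are few or almost pairwise disjoint. -/
theorem IsPartialAffine.exists_isCompletion_of_criteria {W : Type*} [Fintype W] [DecidableEq W]
    {n : ℕ} {L : Finset (Finset W)} (hL : IsPartialAffine n L) (hn : 2 ≤ n)
    (h : ((n : ℝ) ^ 2 + (n : ℝ) - Real.sqrt (n : ℝ) ≤ (L.card : ℝ) ∧ ParallelismIsEquivalence L) ∨
      ((∀ Q R, valency L Q < n → valency L R < n → Q = R) ∧ ParallelismIsEquivalence L) ∨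
      (DowFewMissing n L ∨ DowOneOrTwoMissing n L)) :
    ∃ M, IsCompletion n L M ∧ ((M.card - 1) ^ 2 < n ∨
      ∀ Q R, 2 ≤ valency M Q → 2 ≤ valency M R → Q = R) := by
  have hfew : ∀ e, L.card + e = n ^ 2 + n → (e - 1) ^ 2 < n → (∃ M, IsCompletion n L M) →
      ∃ M, IsCompletion n L M ∧ ((M.card - 1) ^ 2 < n ∨
        ∀ Q R, 2 ≤ valency M Q → 2 ≤ valency M R → Q = R) := by
    rintro e he hen ⟨M, hM⟩
    refine ⟨M, hM, Or.inl ?_⟩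
    rwa [hM.card_eq hL hn he]
  have hpred : ∀ e : ℕ, e ^ 2 ≤ n → (e - 1) ^ 2 < n := by
    intro e he
    rcases Nat.eq_zero_or_pos e with rfl | h0
    · simp; omega
    · exact (Nat.pow_lt_pow_left (by omega : e - 1 < e) two_ne_zero).trans_le he
  rcases h with ⟨hcard, hp⟩ | ⟨hv, hp⟩ | (⟨e, he, h⟩ | h)
  · obtain ⟨e, he⟩ := Nat.exists_eq_add_of_le (hL.card_le hn)
    have hen : e ^ 2 ≤ n := by
      have h1 : (n : ℝ) ^ 2 + n = L.card + e := by exact_mod_cast he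
      have h2 : (e : ℝ) ≤ Real.sqrt n := by linarith
      have h3 := (Real.le_sqrt (Nat.cast_nonneg e) (Nat.cast_nonneg n)).1 h2
      exact_mod_cast h3
    exact hfew e he.symm (hpred e hen)
      (hL.exists_isCompletion_of_equivalence_of_card hn hp he.symm hen)
  · obtain ⟨M, hM⟩ := hL.exists_isCompletion_of_equivalence_of_valency hn hp hv
    refine ⟨M, hM, Or.inr fun Q R hQ hR => ?_⟩
    rw [hM.valency_eq hL hn] at hQ hR
    have h1 := hL.valency_add_defect hn Q
    have h2 := hL.valency_add_defect hn R
    exact hv Q R (by omega) (by omega)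
  · rcases h with ⟨hen, Z, hZ⟩ | ⟨hen, l₀, hl₀, h₀⟩
    · have hen' : (e - 1) ^ 2 < n := by
        rcases Nat.eq_zero_or_pos e with rfl | h0
        · simp; omega
        · have h1 : ((e - 1 : ℕ) : ℝ) < Real.sqrt n := by
            rw [Nat.cast_sub h0, Nat.cast_one]
            linarith
          have h2 := (Real.lt_sqrt (Nat.cast_nonneg _)).1 h1
          exact_mod_cast h2
      have h1 := hL.valency_add_defect hn Z
      exact hfew e he hen' (hL.exists_isCompletion_of_defect_eq hn he hen'
        (by omega : defect n L Z = e))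
    · have hen' : e ^ 2 < n := by
        have h2 := (Real.lt_sqrt (Nat.cast_nonneg _)).1 hen
        exact_mod_cast h2
      refine hfew e he (hpred e hen'.le) (hL.exists_isCompletion_of_full_line hn he hen' hl₀ ?_)
      intro Q hQ
      have h1 := hL.valency_add_defect hn Q
      rw [h₀ Q hQ] at h1
      omega
  · rcases h with ⟨-, he⟩ | ⟨hn4, he⟩
    · exact hfew 1 he (by simp; omega) (hL.exists_isCompletion_of_one_missing hn he)
    · exact hfew 2 he (by simp; omega) (hL.exists_isCompletion_of_two_missing hn4 he)

variable {V : Type*} [DecidableEq V]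

/-- The circle through `P` obtained from a line of the derived structure at `P`. -/
def addPoint (P : V) (l : Finset {Q : V // Q ≠ P}) : Finset V :=
  insert P (l.map (Function.Embedding.subtype _))

theorem mem_addPoint {P : V} {l : Finset {Q : V // Q ≠ P}} {Q : V} (hQ : Q ≠ P) :
    Q ∈ addPoint P l ↔ ⟨Q, hQ⟩ ∈ l := by
  simp [addPoint, hQ]

theorem self_mem_addPoint {P : V} {l : Finset {Q : V // Q ≠ P}} : P ∈ addPoint P l :=
  Finset.mem_insert_self _ _

theorem card_addPoint {P : V} {l : Finset {Q : V // Q ≠ P}} :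
    (addPoint P l).card = l.card + 1 := by
  rw [addPoint, Finset.card_insert_of_notMem, Finset.card_map]
  simp

theorem addPoint_injective (P : V) : Function.Injective (addPoint P) := by
  intro l m h
  ext ⟨Q, hQ⟩
  rw [← mem_addPoint hQ, h, mem_addPoint hQ]

theorem addPoint_subtype {P : V} {c : Finset V} (hP : P ∈ c) :
    addPoint P (c.subtype (fun Q => Q ≠ P)) = c := by
  ext Q
  by_cases hQ : Q = P
  · rw [hQ]
    exact ⟨fun _ => hP, fun _ => self_mem_addPoint⟩
  · rw [mem_addPoint hQ, Finset.mem_subtype]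

theorem addPoint_mem_iff {C : Finset (Finset V)} {P : V} {l : Finset {Q : V // Q ≠ P}} :
    addPoint P l ∈ C ↔ l ∈ derivedLines C P := by
  rw [derivedLines, Finset.mem_image]
  constructor
  · intro h
    exact ⟨_, mem_blocksThrough.2 ⟨h, self_mem_addPoint⟩,
      addPoint_injective P (addPoint_subtype self_mem_addPoint)⟩
  · rintro ⟨c, hc, rfl⟩
    rw [mem_blocksThrough] at hc
    rw [addPoint_subtype hc.2]
    exact hc.1

theorem card_derivedLines (C : Finset (Finset V)) (P : V) :
    (derivedLines C P).card = (blocksThrough C P).card := by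
  refine Finset.card_image_of_injOn fun c hc c' hc' h => ?_
  rw [Finset.mem_coe, mem_blocksThrough] at hc hc'
  rw [← addPoint_subtype hc.2, ← addPoint_subtype hc'.2]
  exact congrArg _ h

theorem valency_image_addPoint {P : V} (N : Finset (Finset {Q : V // Q ≠ P})) {Q : V}
    (hQ : Q ≠ P) : valency (N.image (addPoint P)) Q = valency N ⟨Q, hQ⟩ := by
  unfold valency blocksThrough
  rw [Finset.filter_image, Finset.card_image_of_injective _ (addPoint_injective P)]
  simp only [mem_addPoint hQ]

variable {n : ℕ} {C : Finset (Finset V)}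

/-- Completions of all derived structures give new circles at each point. -/
theorem isDerivedCompletion_of_isCompletion
    {N : ∀ P : V, Finset (Finset {Q : V // Q ≠ P})}
    (hN : ∀ P, IsCompletion n (derivedLines C P) (N P)) :
    IsDerivedCompletion n C (fun P => (N P).image (addPoint P)) where
  mem P b hb := by
    obtain ⟨l, -, rfl⟩ := Finset.mem_image.1 hb
    exact self_mem_addPoint
  card P b hb := by
    obtain ⟨l, hl, rfl⟩ := Finset.mem_image.1 hb
    rw [card_addPoint, (hN P).card_line l hl]
  notMem P b hb hbC := by
    obtain ⟨l, hl, rfl⟩ := Finset.mem_image.1 hb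
    exact Finset.disjoint_left.1 (hN P).disjoint (addPoint_mem_iff.1 hbC) hl
  existsUnique P Q R hPQ hPR hQR := by
    obtain ⟨l, ⟨hl, hQ, hR⟩, huniq⟩ := (hN P).existsUnique ⟨Q, hPQ.symm⟩ ⟨R, hPR.symm⟩
      (fun h => hQR (congrArg Subtype.val h))
    refine ⟨addPoint P l, ⟨?_, self_mem_addPoint, (mem_addPoint _).2 hQ, (mem_addPoint _).2 hR⟩, ?_⟩
    · rcases Finset.mem_union.1 hl with hl | hl
      · exact Or.inl (addPoint_mem_iff.2 hl)
      · exact Or.inr (Finset.mem_image_of_mem _ hl)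
    · rintro b ⟨hb, hPb, hQb, hRb⟩
      rw [← addPoint_subtype hPb] at hb ⊢
      congr 1
      refine huniq _ ⟨?_, Finset.mem_subtype.2 hQb, Finset.mem_subtype.2 hRb⟩
      rw [Finset.mem_union]
      refine hb.imp addPoint_mem_iff.1 fun h => ?_
      obtain ⟨m, hm, h⟩ := Finset.mem_image.1 h
      rwa [← addPoint_injective P h]

variable [Fintype V]

theorem IsPartialInversivePlane.isPartialAffine (hC : IsPartialInversivePlane n C) (P : V) :
    IsPartialAffine n (derivedLines C P) := by
  refine ⟨?_, ?_, ?_⟩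
  · have := Fintype.card_subtype_compl (fun Q : V => Q = P)
    rw [Fintype.card_subtype_eq, hC.1, Nat.add_sub_cancel] at this
    exact this
  · intro l hl
    have := hC.2.1 _ (addPoint_mem_iff.2 hl)
    rw [card_addPoint] at this
    omega
  · rintro l hl m hm ⟨Q, hQ⟩ ⟨R, hR⟩ hne hQl hRl hQm hRm
    have hne' : Q ≠ R := fun h => hne (Subtype.ext h)
    have h3 : ({P, Q, R} : Finset V).card = 3 :=
      Finset.card_eq_three.2 ⟨P, Q, R, hQ.symm, hR.symm, hne', rfl⟩
    have hmem : ∀ l ∈ derivedLines C P, ⟨Q, hQ⟩ ∈ l → ⟨R, hR⟩ ∈ l →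
        addPoint P l ∈ C.filter (fun b => {P, Q, R} ⊆ b) := by
      intro l hl hQl hRl
      rw [Finset.mem_filter]
      simp only [Finset.insert_subset_iff, Finset.singleton_subset_iff]
      exact ⟨addPoint_mem_iff.2 hl, self_mem_addPoint, (mem_addPoint hQ).2 hQl,
        (mem_addPoint hR).2 hRl⟩
    exact addPoint_injective P (Finset.card_le_one.1 (hC.2.2 _ h3) _ (hmem l hl hQl hRl) _
      (hmem m hm hQm hRm))

/-- Partial inversive planes of order at most two are completed by all triples of points. -/
theorem IsPartialInversivePlane.exists_isInversivePlane_of_le_two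
    (hC : IsPartialInversivePlane n C) (hn : n ≤ 2) :
    ∃ C' : Finset (Finset V), C ⊆ C' ∧ IsInversivePlane n C' := by
  rcases hn.eq_or_lt with rfl | hn
  · refine ⟨Finset.univ.powersetCard 3, ?_, hC.1, ?_, ?_⟩
    · exact fun c hc => Finset.mem_powersetCard.2 ⟨Finset.subset_univ _, hC.2.1 c hc⟩
    · exact fun c hc => (Finset.mem_powersetCard.1 hc).2
    · intro T hT
      rw [Finset.card_eq_one]
      refine ⟨T, ?_⟩
      ext b
      rw [Finset.mem_filter, Finset.mem_powersetCard, Finset.mem_singleton]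
      constructor
      · rintro ⟨⟨-, hb⟩, hTb⟩
        exact (Finset.eq_of_subset_of_card_le hTb (by rw [hb, hT])).symm
      · rintro rfl
        exact ⟨⟨Finset.subset_univ _, hT⟩, subset_rfl⟩
  -- For `n ≤ 1` there are at most two points, so no triple has to be covered.
  · refine ⟨C, subset_rfl, hC.1, hC.2.1, fun T hT => ?_⟩
    have h1 := Finset.card_le_univ T
    rw [hT, hC.1] at h1
    have : n ^ 2 ≤ 1 := by interval_cases n <;> simp
    omega

end Assembly

theorem corollary3p4 {V : Type*} [Fintype V] [DecidableEq V] (n : ℕ)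
    (C : Finset (Finset V)) (hC : IsPartialInversivePlane n C)
    (h : ∀ P : V,
      ((n : ℝ) ^ 2 + (n : ℝ) - Real.sqrt (n : ℝ) ≤ ((blocksThrough C P).card : ℝ) ∧
        ParallelismIsEquivalence (derivedLines C P)) ∨
      ((∀ Q R : {Q : V // Q ≠ P}, valency (derivedLines C P) Q < n →
          valency (derivedLines C P) R < n → Q = R) ∧
        ParallelismIsEquivalence (derivedLines C P)) ∨
      (DowFewMissing n (derivedLines C P) ∨ DowOneOrTwoMissing n (derivedLines C P))) :
    ∃ C' : Finset (Finset V), C ⊆ C' ∧ IsInversivePlane n C' := by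
  rcases le_or_gt n 2 with hn | hn
  · exact hC.exists_isInversivePlane_of_le_two hn
  have hn2 : 2 ≤ n := hn.le
  have hex : ∀ P, ∃ N, IsCompletion n (derivedLines C P) N ∧ ((N.card - 1) ^ 2 < n ∨
      ∀ Q R, 2 ≤ valency N Q → 2 ≤ valency N R → Q = R) := fun P => by
    refine (hC.isPartialAffine P).exists_isCompletion_of_criteria hn2 ?_
    rw [card_derivedLines]
    exact h P
  choose N hN hsmall using hex
  refine (isDerivedCompletion_of_isCompletion hN).exists_isInversivePlane hn2 hC fun P => ?_
  rw [Finset.card_image_of_injective _ (addPoint_injective P)]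
  refine (hsmall P).imp_right fun h Q R hQ hR hvQ hvR => ?_
  rw [valency_image_addPoint _ hQ] at hvQ
  rw [valency_image_addPoint _ hR] at hvR
  exact congrArg Subtype.val (h _ _ hvQ hvR)
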